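/- Let $R$ be an associative unital ring and let $M$ be an $R$-bimodule that is nilpotent, i.e. $M^{\otimes_R (N+1)}=0$ for some $N\ge 0$, where $M^{\otimes_R 0}=R$ and $M^{\otimes_R(i+1)}=M\otimes_R M^{\otimes_R i}$. Let $T=T_R(M)=\bigoplus_{i\ge 0}M^{\otimes_R i}$ be the tensor ring. Right modules over a ring $A$ are regarded as $A^{\mathrm{op}}$-modules. For an $R$-bimodule $X$ and a right $R$-module $Y$, $\operatorname{Hom}_{R^{\mathrm{op}}}(X,Y)$ is a right $R$-module via $(fr)(x)=f(rx)$. A right $T$-module is written as a pair $[Y,v]$, where $Y$ is its underlying right $R$-module and $v\colon Y\to \operatorname{Hom}_{R^{\mathrm{op}}}(M,Y)$ is the $R^{\mathrm{op}}$-homomorphism $v(y)(m)=ym$. Let $\operatorname{Coind}(Y)=\operatorname{Hom}_{R^{\mathrm{op}}}(T,Y)$ be the right adjoint of the forgetful functor from right $T$-modules to right $R$-modules. A complete injective resolution over a ring $A$ is an exact sequence $I^\bullet=(\cdots\to I^{-1}\to I^0\to I^1\to\cdots)$ of injective $A$-modules such that $\operatorname{Hom}_A(E,I^\bullet)$ is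 exact for every injective $A$-module $E$. An $A$-module is Gorenstein injective if it is isomorphic to $\ker(I^0\to I^1)$ for some complete injective resolution $I^\bullet$. Suppose that (a) $M$ is co-compatible: for every complete injective resolution $I^\bullet$ of $T^{\mathrm{op}}$-modules, the complex $\operatorname{Hom}_{R^{\mathrm{op}}}(M,I^\bullet)$ is exact, and the complex $\operatorname{Hom}_{T^{\mathrm{op}}}(\operatorname{Coind}(\operatorname{Hom}_{R^{\mathrm{op}}}(M,E)),I^\bullet)$ is exact for every injective $R^{\mathrm{op}}$-module $E$; and (b) $M$ is co-admissible: $\operatorname{Ext}^1_{R^{\mathrm{op}}}(\operatorname{Hom}_{R^{\mathrm{op}}}(M^{\otimes_R i},E),H)=0=\operatorname{Ext}^1_{R^{\mathrm{op}}}(M,\operatorname{Hom}_{R^{\mathrm{op}}}(M^{\otimes_R i},H))$ for every Gorenstein injective $R^{\mathrm{op}}$-module $H$, every injective $R^{\mathrm{op}}$-module $E$ and every $i\ge 0$. Then a right $T$-module $[Y,v]$ is Gorenstein injective (as a $T^{\mathrm{op}}$-module) if and only if $v$ is an epimorphism and $\ker v$ is a Gorenstein injective $R^{\mathrm{op}}$-module.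 -/

import Mathlib

open CategoryTheory MulOpposite
open scoped TensorProduct DirectSum

universe u

noncomputable section

namespace TensorRings

/-! ### Tensor product over a (noncommutative) ring -/

section BalTensor

variable (R : Type u) [Ring R]
variable (A : Type u) [AddCommGroup A] [Module Rᵐᵒᵖ A]
variable (B : Type u) [AddCommGroup B] [Module R B]

/-- The subgroup of `A ⊗_ℤ B` generated by the elements `a r ⊗ b - a ⊗ r b`. -/
def balancedRel : AddSubgroup (A ⊗[ℤ] B) :=
  AddSubgroup.closure {t | ∃ (a : A) (r : R) (b : B), t = (op r • a) ⊗ₜ[ℤ] b - a ⊗ₜ[ℤ] (r • b)}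

/-- The tensor product `A ⊗_R B` of a right `R`-module `A` and a left `R`-module `B`. -/
def BalTensor : Type u := (A ⊗[ℤ] B) ⧸ balancedRel R A B

instance : AddCommGroup (BalTensor R A B) :=
  inferInstanceAs (AddCommGroup ((A ⊗[ℤ] B) ⧸ balancedRel R A B))

end BalTensor

namespace BalTensor

variable (R : Type u) [Ring R]
variable {A : Type u} [AddCommGroup A] [Module Rᵐᵒᵖ A]
variable {B : Type u} [AddCommGroup B] [Module R B]

variable (A B) in
/-- The quotient map `A ⊗_ℤ B → A ⊗_R B`. -/
def mk : A ⊗[ℤ] B →+ BalTensor R A B := QuotientAddGroup.mk' (balancedRel R A B)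

/-- The pure tensor `a ⊗ b`, as a biadditive map. -/
def tmulHom : A →+ B →+ BalTensor R A B where
  toFun a :=
    { toFun := fun b => mk R A B (a ⊗ₜ[ℤ] b)
      map_zero' := by rw [TensorProduct.tmul_zero, map_zero]
      map_add' := fun b b' => by rw [TensorProduct.tmul_add, map_add] }
  map_zero' := by
    ext b
    change mk R A B ((0 : A) ⊗ₜ[ℤ] b) = 0
    rw [TensorProduct.zero_tmul, map_zero]
  map_add' a a' := by
    ext b
    change mk R A B ((a + a') ⊗ₜ[ℤ] b) = mk R A B (a ⊗ₜ[ℤ] b) + mk R A B (a' ⊗ₜ[ℤ] b)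
    rw [TensorProduct.add_tmul, map_add]

/-- The pure tensor `a ⊗ b` in `A ⊗_R B`. -/
def tmul (a : A) (b : B) : BalTensor R A B := tmulHom R a b

theorem smul_tmul (r : R) (a : A) (b : B) : tmul R (op r • a) b = tmul R a (r • b) := by
  refine QuotientAddGroup.eq_iff_sub_mem.mpr ?_
  exact AddSubgroup.subset_closure ⟨a, r, b, rfl⟩

theorem add_tmul (a a' : A) (b : B) : tmul R (a + a') b = tmul R a b + tmul R a' b :=
  DFunLike.congr_fun (map_add (tmulHom R) a a') b

theorem tmul_add (a : A) (b b' : B) : tmul R a (b + b') = tmul R a b + tmul R a b' :=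
  map_add (tmulHom R a) b b'

theorem zero_tmul (b : B) : tmul R (0 : A) b = 0 :=
  DFunLike.congr_fun (map_zero (tmulHom R)) b

theorem tmul_zero (a : A) : tmul R a (0 : B) = 0 := map_zero (tmulHom R a)

variable {R} in
@[elab_as_elim]
theorem induction_on {p : BalTensor R A B → Prop} (t : BalTensor R A B)
    (zero : p 0) (tmul : ∀ a b, p (tmul R a b)) (add : ∀ x y, p x → p y → p (x + y)) : p t := by
  obtain ⟨s, rfl⟩ := QuotientAddGroup.mk'_surjective (balancedRel R A B) t
  change p (mk R A B s)
  induction s using TensorProduct.induction_on with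
  | zero => rw [map_zero]; exact zero
  | tmul a b => exact tmul a b
  | add x y hx hy => rw [map_add]; exact add _ _ hx hy

variable {R} in
theorem hom_ext {C : Type*} [AddCommGroup C] {f g : BalTensor R A B →+ C}
    (h : ∀ a b, f (tmul R a b) = g (tmul R a b)) : f = g := by
  ext t
  induction t using induction_on with
  | zero => rw [map_zero, map_zero]
  | tmul a b => exact h a b
  | add x y hx hy => rw [map_add, map_add, hx, hy]

/-- The additive map out of `A ⊗_R B` induced by an `R`-balanced biadditive map. -/
def lift {C : Type*} [AddCommGroup C] (f : A →+ B →+ C)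
    (hf : ∀ (r : R) a b, f (op r • a) b = f a (r • b)) : BalTensor R A B →+ C :=
  QuotientAddGroup.lift (balancedRel R A B)
    (TensorProduct.liftAddHom f fun n a b => by
      rw [map_zsmul, map_zsmul, AddMonoidHom.zsmul_apply])
    (by
      rw [balancedRel, AddSubgroup.closure_le]
      rintro _ ⟨a, r, b, rfl⟩
      rw [SetLike.mem_coe, AddMonoidHom.mem_ker, map_sub, TensorProduct.liftAddHom_tmul,
        TensorProduct.liftAddHom_tmul, hf, sub_self])

theorem lift_tmul {C : Type*} [AddCommGroup C] (f : A →+ B →+ C)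
    (hf : ∀ (r : R) a b, f (op r • a) b = f a (r • b)) (a : A) (b : B) :
    lift R f hf (tmul R a b) = f a b := rfl

section Left

variable [Module R A] [SMulCommClass R Rᵐᵒᵖ A]

/-- Left multiplication `r (a ⊗ b) = r a ⊗ b`. -/
def smulLeft (r : R) : BalTensor R A B →+ BalTensor R A B :=
  lift R ((tmulHom R).comp (DistribSMul.toAddMonoidHom A r)) (fun s a b => by
    change tmul R (r • op s • a) b = tmul R (r • a) (s • b)
    rw [smul_comm, smul_tmul])

theorem smulLeft_tmul (r : R) (a : A) (b : B) : smulLeft R r (tmul R a b) = tmul R (r • a) b := rfl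

instance : Module R (BalTensor R A B) where
  smul r t := smulLeft R r t
  one_smul t := DFunLike.congr_fun (f := smulLeft R (1 : R)) (g := AddMonoidHom.id _)
    (hom_ext fun a b => by rw [smulLeft_tmul, one_smul, AddMonoidHom.id_apply]) t
  mul_smul r s t := DFunLike.congr_fun (f := smulLeft R (r * s))
    (g := (smulLeft R r).comp (smulLeft R s))
    (hom_ext fun a b => by
      rw [AddMonoidHom.comp_apply, smulLeft_tmul, smulLeft_tmul, smulLeft_tmul, mul_smul]) t
  smul_zero r := map_zero (smulLeft R r)
  smul_add r := map_add (smulLeft R r)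
  add_smul r s t := DFunLike.congr_fun (f := smulLeft R (r + s)) (g := smulLeft R r + smulLeft R s)
    (hom_ext fun a b => by
      rw [AddMonoidHom.add_apply, smulLeft_tmul, smulLeft_tmul, smulLeft_tmul, add_smul,
        add_tmul]) t
  zero_smul t := DFunLike.congr_fun (f := smulLeft R (0 : R)) (g := 0)
    (hom_ext fun a b => by
      rw [AddMonoidHom.zero_apply, smulLeft_tmul, zero_smul, zero_tmul]) t

theorem smul_left_tmul (r : R) (a : A) (b : B) : r • tmul R a b = tmul R (r • a) b := rfl

end Left

section Right

variable [Module Rᵐᵒᵖ B] [SMulCommClass R Rᵐᵒᵖ B]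

/-- Right multiplication `(a ⊗ b) r = a ⊗ b r`. -/
def smulRight (r : Rᵐᵒᵖ) : BalTensor R A B →+ BalTensor R A B :=
  lift R ((AddMonoidHom.compHom.flip (DistribSMul.toAddMonoidHom B r)).comp (tmulHom R))
    (fun s a b => by
      change tmul R (op s • a) (r • b) = tmul R a (r • s • b)
      rw [smul_tmul, smul_comm])

theorem smulRight_tmul (r : Rᵐᵒᵖ) (a : A) (b : B) :
    smulRight R r (tmul R a b) = tmul R a (r • b) := rfl

instance : Module Rᵐᵒᵖ (BalTensor R A B) where
  smul r t := smulRight R r t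
  one_smul t := DFunLike.congr_fun (f := smulRight R (1 : Rᵐᵒᵖ)) (g := AddMonoidHom.id _)
    (hom_ext fun a b => by rw [smulRight_tmul, one_smul, AddMonoidHom.id_apply]) t
  mul_smul r s t := DFunLike.congr_fun (f := smulRight R (r * s))
    (g := (smulRight R r).comp (smulRight R s))
    (hom_ext fun a b => by
      rw [AddMonoidHom.comp_apply, smulRight_tmul, smulRight_tmul, smulRight_tmul, mul_smul]) t
  smul_zero r := map_zero (smulRight R r)
  smul_add r := map_add (smulRight R r)
  add_smul r s t := DFunLike.congr_fun (f := smulRight R (r + s))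
    (g := smulRight R r + smulRight R s)
    (hom_ext fun a b => by
      rw [AddMonoidHom.add_apply, smulRight_tmul, smulRight_tmul, smulRight_tmul, add_smul,
        tmul_add]) t
  zero_smul t := DFunLike.congr_fun (f := smulRight R (0 : Rᵐᵒᵖ)) (g := 0)
    (hom_ext fun a b => by
      rw [AddMonoidHom.zero_apply, smulRight_tmul, zero_smul, tmul_zero]) t

theorem smul_right_tmul (r : Rᵐᵒᵖ) (a : A) (b : B) : r • tmul R a b = tmul R a (r • b) := rfl

end Right

instance [Module R A] [SMulCommClass R Rᵐᵒᵖ A] [Module Rᵐᵒᵖ B] [SMulCommClass R Rᵐᵒᵖ B] :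
    SMulCommClass R Rᵐᵒᵖ (BalTensor R A B) where
  smul_comm r s t := DFunLike.congr_fun (f := (smulLeft R r).comp (smulRight R s))
    (g := (smulRight R s).comp (smulLeft R r)) (hom_ext fun a b => by
      rw [AddMonoidHom.comp_apply, AddMonoidHom.comp_apply, smulLeft_tmul, smulRight_tmul,
        smulRight_tmul, smulLeft_tmul]) t

end BalTensor

/-! ### Tensor powers of a bimodule -/

/-- A bundled `R`-bimodule; right `R`-modules are modules over `Rᵐᵒᵖ`. -/
structure Bimodule (R : Type u) [Ring R] where
  carrier : Type u
  [addCommGroup : AddCommGroup carrier]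
  [left : Module R carrier]
  [right : Module Rᵐᵒᵖ carrier]
  [smulComm : SMulCommClass R Rᵐᵒᵖ carrier]

attribute [instance] Bimodule.addCommGroup Bimodule.left Bimodule.right Bimodule.smulComm

variable (R : Type u) [Ring R]
variable (M : Type u) [AddCommGroup M] [Module R M] [Module Rᵐᵒᵖ M] [SMulCommClass R Rᵐᵒᵖ M]

/-- The tensor powers as bundled bimodules: `R` in degree `0`, and `M ⊗_R (i-th power)` in
degree `i + 1`. -/
def tensorPowerBimodule : ℕ → Bimodule R
  | 0 => ⟨R⟩
  | i + 1 => ⟨BalTensor R M (tensorPowerBimodule i).carrier⟩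

/-- The tensor power `M^{⊗_R i}`. -/
abbrev TPow (i : ℕ) : Type u := (tensorPowerBimodule R M i).carrier

/-- `M` is `N`-nilpotent if `M^{⊗_R (N+1)} = 0`. -/
def IsNilpotentBimodule (N : ℕ) : Prop := Subsingleton (TPow R M (N + 1))

namespace TPow

/-- The identification `R = M^{⊗ 0}`. -/
def scalar : R ≃+ TPow R M 0 := AddEquiv.refl R

/-- `m ↦ x ↦ m ⊗ x`, from `M` and `M^{⊗ i}` to `M^{⊗ (i+1)}`. -/
def cons (i : ℕ) : M →+ TPow R M i →+ TPow R M (i + 1) :=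
  BalTensor.tmulHom R

theorem cons_op_smul (i : ℕ) (r : R) (m : M) (x : TPow R M i) :
    cons R M i (op r • m) x = cons R M i m (r • x) :=
  BalTensor.smul_tmul R r m x

theorem smul_cons (i : ℕ) (r : R) (m : M) (x : TPow R M i) :
    r • cons R M i m x = cons R M i (r • m) x := rfl

theorem op_smul_cons (i : ℕ) (r : Rᵐᵒᵖ) (m : M) (x : TPow R M i) :
    r • cons R M i m x = cons R M i m (r • x) := rfl

theorem smul_scalar (r s : R) : r • scalar R M s = scalar R M (r * s) := rfl

theorem op_smul_scalar (r s : R) : op r • scalar R M s = scalar R M (s * r) := rfl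

variable {R M} in
@[elab_as_elim]
theorem succ_induction {i : ℕ} {p : TPow R M (i + 1) → Prop} (t : TPow R M (i + 1))
    (zero : p 0) (cons : ∀ m x, p (cons R M i m x)) (add : ∀ x y, p x → p y → p (x + y)) : p t :=
  BalTensor.induction_on (p := p) t zero cons add

/-- The additive map out of `M^{⊗ (i+1)}` induced by a balanced biadditive map. -/
def succLift {C : Type*} [AddCommGroup C] (i : ℕ) (f : M →+ TPow R M i →+ C)
    (hf : ∀ (r : R) m x, f (op r • m) x = f m (r • x)) : TPow R M (i + 1) →+ C :=
  BalTensor.lift R f hf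

theorem succLift_cons {C : Type*} [AddCommGroup C] (i : ℕ) (f : M →+ TPow R M i →+ C)
    (hf : ∀ (r : R) m x, f (op r • m) x = f m (r • x)) (m : M) (x : TPow R M i) :
    succLift R M i f hf (cons R M i m x) = f m x := rfl

end TPow

/-! ### The tensor ring -/

/-- The tensor ring `T_R(M) = ⨁ i, M^{⊗_R i}`. -/
def TensorRing : Type u := ⨁ i, TPow R M i

namespace TensorRing

instance instAddCommGroup : AddCommGroup (TensorRing R M) :=
  inferInstanceAs (AddCommGroup (⨁ i, TPow R M i))

instance instModule : Module R (TensorRing R M) := inferInstanceAs (Module R (⨁ i, TPow R M i))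

/-- The inclusion of the `i`-th homogeneous component. -/
def of (i : ℕ) : TPow R M i →+ TensorRing R M := DirectSum.of (fun i => TPow R M i) i

/-- The additive map out of `T_R(M)` given by its restrictions to the homogeneous components. -/
def toAdd {C : Type*} [AddCommGroup C] (f : ∀ i, TPow R M i →+ C) : TensorRing R M →+ C :=
  DirectSum.toAddMonoid f

theorem toAdd_of {C : Type*} [AddCommGroup C] (f : ∀ i, TPow R M i →+ C) (i : ℕ)
    (x : TPow R M i) : toAdd R M f (of R M i x) = f i x :=
  DirectSum.toAddMonoid_of f i x

variable {R M} in
@[elab_as_elim]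
theorem induction_on {p : TensorRing R M → Prop} (t : TensorRing R M) (zero : p 0)
    (of : ∀ i x, p (of R M i x)) (add : ∀ x y, p x → p y → p (x + y)) : p t :=
  DirectSum.induction_on (motive := p) t zero of add

theorem smul_of (r : R) (i : ℕ) (x : TPow R M i) : r • of R M i x = of R M i (r • x) :=
  ((DirectSum.lof R ℕ (fun i => TPow R M i) i).map_smul r x).symm

/-- Left multiplication by a scalar. -/
def lsmul : R →+ TensorRing R M →+ TensorRing R M :=
  (Module.toAddMonoidEnd R (TensorRing R M)).toAddMonoidHom

theorem lsmul_apply (r : R) (t : TensorRing R M) : lsmul R M r t = r • t := rfl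

/-- Left multiplication by an element of `M`: it maps `x` in degree `i` to `m ⊗ x` in degree
`i + 1`. -/
def shift : M →+ TensorRing R M →+ TensorRing R M :=
  (toAdd R M fun i => ((of R M (i + 1)).compHom.comp (TPow.cons R M i)).flip).flip

theorem shift_of (m : M) (i : ℕ) (x : TPow R M i) :
    shift R M m (of R M i x) = of R M (i + 1) (TPow.cons R M i m x) :=
  DFunLike.congr_fun (toAdd_of R M
    (fun i => ((of R M (i + 1)).compHom.comp (TPow.cons R M i)).flip) i x) m

theorem shift_op_smul (r : R) (m : M) (t : TensorRing R M) :
    shift R M (op r • m) t = shift R M m (r • t) := by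
  refine induction_on t ?_ (fun i x => ?_) (fun x y hx hy => ?_)
  · rw [smul_zero, map_zero, map_zero]
  · rw [shift_of, smul_of, shift_of, TPow.cons_op_smul]
  · rw [smul_add, map_add, map_add, hx, hy]

theorem shift_smul (r : R) (m : M) (t : TensorRing R M) :
    shift R M (r • m) t = r • shift R M m t := by
  refine induction_on t ?_ (fun i x => ?_) (fun x y hx hy => ?_)
  · rw [map_zero, map_zero, smul_zero]
  · rw [shift_of, shift_of, smul_of, TPow.smul_cons]
  · rw [map_add, map_add, smul_add, hx, hy]

/-- Left multiplication by elements of `M^{⊗ i}`, determined by `r · t = r t` in degree `0` and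
`(m ⊗ x) · t = m ⊗ (x · t)`. -/
def mulAux : ∀ i : ℕ, {f : TPow R M i →+ TensorRing R M →+ TensorRing R M //
    ∀ (r : R) x t, f (r • x) t = r • f x t}
  | 0 => ⟨(lsmul R M).comp (TPow.scalar R M).symm.toAddMonoidHom,
      fun r x t => mul_smul r ((TPow.scalar R M).symm x) t⟩
  | i + 1 =>
    ⟨TPow.succLift R M i
      ((AddMonoidHom.compHom.flip (mulAux i).1).comp (AddMonoidHom.compHom.comp (shift R M)))
      (fun r m x => by
        ext t
        change shift R M (op r • m) ((mulAux i).1 x t) = shift R M m ((mulAux i).1 (r • x) t)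
        rw [(mulAux i).2, shift_op_smul]),
    fun r x t => by
      refine TPow.succ_induction x ?_ (fun m y => ?_) (fun y z hy hz => ?_)
      · rw [smul_zero, map_zero, AddMonoidHom.zero_apply, smul_zero]
      · rw [TPow.smul_cons, TPow.succLift_cons, TPow.succLift_cons]
        exact shift_smul R M r m _
      · rw [smul_add, map_add, map_add, AddMonoidHom.add_apply, AddMonoidHom.add_apply, smul_add,
          hy, hz]⟩

/-- The multiplication of the tensor ring, the biadditive extension of the concatenation
`M^{⊗ i} × M^{⊗ j} → M^{⊗ (i+j)}`. -/
def mulHom : TensorRing R M →+ TensorRing R M →+ TensorRing R M :=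
  toAdd R M fun i => (mulAux R M i).1

theorem mulHom_of (i : ℕ) (x : TPow R M i) : mulHom R M (of R M i x) = (mulAux R M i).1 x :=
  toAdd_of R M _ i x

theorem mulHom_scalar (r : R) (t : TensorRing R M) :
    mulHom R M (of R M 0 (TPow.scalar R M r)) t = r • t := by
  rw [mulHom_of]
  rfl

theorem mulHom_cons (i : ℕ) (m : M) (x : TPow R M i) (t : TensorRing R M) :
    mulHom R M (of R M (i + 1) (TPow.cons R M i m x)) t =
      shift R M m (mulHom R M (of R M i x) t) := by
  rw [mulHom_of, mulHom_of]
  rfl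

theorem mulHom_smul (r : R) (s t : TensorRing R M) :
    mulHom R M (r • s) t = r • mulHom R M s t := by
  refine induction_on s ?_ (fun i x => ?_) (fun x y hx hy => ?_)
  · rw [smul_zero, map_zero, AddMonoidHom.zero_apply, smul_zero]
  · rw [smul_of, mulHom_of, mulHom_of, (mulAux R M i).2]
  · rw [smul_add, map_add, map_add, AddMonoidHom.add_apply, AddMonoidHom.add_apply, hx, hy,
      smul_add]

theorem mulHom_shift (m : M) (s t : TensorRing R M) :
    mulHom R M (shift R M m s) t = shift R M m (mulHom R M s t) := by
  refine induction_on s ?_ (fun i x => ?_) (fun x y hx hy => ?_)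
  · rw [map_zero, map_zero, AddMonoidHom.zero_apply, map_zero]
  · rw [shift_of, mulHom_cons]
  · rw [map_add, map_add, map_add, AddMonoidHom.add_apply, AddMonoidHom.add_apply, map_add, hx, hy]

theorem mulHom_of_assoc (i : ℕ) (x : TPow R M i) (s t : TensorRing R M) :
    mulHom R M (mulHom R M (of R M i x) s) t = mulHom R M (of R M i x) (mulHom R M s t) := by
  induction i with
  | zero =>
    obtain ⟨r, rfl⟩ := (TPow.scalar R M).surjective x
    rw [mulHom_scalar, mulHom_scalar, mulHom_smul]
  | succ i ih =>
    refine TPow.succ_induction x ?_ (fun m y => ?_) (fun y z hy hz => ?_)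
    · rw [map_zero, map_zero, AddMonoidHom.zero_apply, AddMonoidHom.zero_apply, map_zero,
        AddMonoidHom.zero_apply]
    · rw [mulHom_cons, mulHom_cons, mulHom_shift, ih]
    · rw [map_add, map_add, AddMonoidHom.add_apply, AddMonoidHom.add_apply, map_add,
        AddMonoidHom.add_apply, hy, hz]

theorem mulHom_assoc (s t w : TensorRing R M) :
    mulHom R M (mulHom R M s t) w = mulHom R M s (mulHom R M t w) := by
  refine induction_on s ?_ (fun i x => ?_) (fun x y hx hy => ?_)
  · rw [map_zero, AddMonoidHom.zero_apply, AddMonoidHom.zero_apply, map_zero,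
      AddMonoidHom.zero_apply]
  · exact mulHom_of_assoc R M i x t w
  · rw [map_add, AddMonoidHom.add_apply, AddMonoidHom.add_apply, map_add, AddMonoidHom.add_apply,
      hx, hy]

/-- The unit of the tensor ring, `1 ∈ R` in degree `0`. -/
def unit : TensorRing R M := of R M 0 (TPow.scalar R M 1)

theorem mulHom_unit_left (t : TensorRing R M) : mulHom R M (unit R M) t = t := by
  rw [unit, mulHom_scalar, one_smul]

theorem mulHom_of_unit (i : ℕ) (x : TPow R M i) :
    mulHom R M (of R M i x) (unit R M) = of R M i x := by
  induction i with
  | zero =>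
    obtain ⟨r, rfl⟩ := (TPow.scalar R M).surjective x
    rw [mulHom_scalar, unit, smul_of, TPow.smul_scalar, mul_one]
  | succ i ih =>
    refine TPow.succ_induction x ?_ (fun m y => ?_) (fun y z hy hz => ?_)
    · rw [map_zero, map_zero, AddMonoidHom.zero_apply]
    · rw [mulHom_cons, ih, shift_of]
    · rw [map_add, map_add, AddMonoidHom.add_apply, hy, hz]

theorem mulHom_unit_right (t : TensorRing R M) : mulHom R M t (unit R M) = t := by
  refine induction_on t ?_ (fun i x => ?_) (fun x y hx hy => ?_)
  · rw [map_zero, AddMonoidHom.zero_apply]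
  · exact mulHom_of_unit R M i x
  · rw [map_add, AddMonoidHom.add_apply, hx, hy]

instance instRing : Ring (TensorRing R M) where
  __ := instAddCommGroup R M
  mul s t := mulHom R M s t
  one := unit R M
  mul_assoc s t w := mulHom_assoc R M s t w
  one_mul t := mulHom_unit_left R M t
  mul_one t := mulHom_unit_right R M t
  left_distrib s t w := map_add (mulHom R M s) t w
  right_distrib s t w := DFunLike.congr_fun (map_add (mulHom R M) s t) w
  zero_mul t := DFunLike.congr_fun (map_zero (mulHom R M)) t
  mul_zero s := map_zero (mulHom R M s)

theorem mul_def (s t : TensorRing R M) : s * t = mulHom R M s t := rfl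

/-- The inclusion `R → T_R(M)` as the component of degree `0`. -/
def incl : R →+* TensorRing R M where
  toFun r := of R M 0 (TPow.scalar R M r)
  map_one' := rfl
  map_mul' r s := by rw [mul_def, mulHom_scalar, smul_of, TPow.smul_scalar]
  map_zero' := by rw [map_zero, map_zero]
  map_add' r s := by rw [map_add, map_add]

/-- The inclusion `M ≅ M ⊗_R R → T_R(M)` as the component of degree `1`. -/
def gen : M →+ TensorRing R M where
  toFun m := of R M 1 (TPow.cons R M 0 m (TPow.scalar R M 1))
  map_zero' := by rw [map_zero, AddMonoidHom.zero_apply, map_zero]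
  map_add' m m' := by rw [map_add, AddMonoidHom.add_apply, map_add]

theorem incl_apply (r : R) : incl R M r = of R M 0 (TPow.scalar R M r) := rfl

theorem gen_apply (m : M) : gen R M m = of R M 1 (TPow.cons R M 0 m (TPow.scalar R M 1)) := rfl

theorem incl_mul (r : R) (t : TensorRing R M) : incl R M r * t = r • t :=
  mulHom_scalar R M r t

theorem gen_mul (m : M) (t : TensorRing R M) : gen R M m * t = shift R M m t := by
  rw [gen_apply, mul_def, mulHom_cons, mulHom_scalar, one_smul]

theorem gen_smul (r : R) (m : M) : gen R M (r • m) = incl R M r * gen R M m := by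
  rw [incl_mul, gen_apply, gen_apply, smul_of, TPow.smul_cons]

theorem gen_op_smul (r : R) (m : M) : gen R M (op r • m) = gen R M m * incl R M r := by
  rw [gen_mul, incl_apply, gen_apply, shift_of, TPow.cons_op_smul, TPow.smul_scalar, mul_one]

end TensorRing

/-! ### The right module `Hom_{R^op}(X, Y)` -/

section RHom

variable (X : Type u) [AddCommGroup X] [Module Rᵐᵒᵖ X]
variable (Y : Type u) [AddCommGroup Y] [Module Rᵐᵒᵖ Y]

/-- The group `Hom_{R^op}(X, Y)` of maps of right `R`-modules. It is a type of its own, because it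
carries the right `R`-module structure that comes from the left structure of a bimodule `X`. -/
def RHom : Type u := X →ₗ[Rᵐᵒᵖ] Y

instance : AddCommGroup (RHom R X Y) := inferInstanceAs (AddCommGroup (X →ₗ[Rᵐᵒᵖ] Y))

namespace RHom

/-- An element of `Hom_{R^op}(X, Y)` as a linear map. -/
def equiv : RHom R X Y ≃+ (X →ₗ[Rᵐᵒᵖ] Y) := AddEquiv.refl _

variable {R X Y} in
theorem ext {f g : RHom R X Y} (h : ∀ x, equiv R X Y f x = equiv R X Y g x) : f = g :=
  (equiv R X Y).injective (LinearMap.ext h)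

variable [Module R X] [SMulCommClass R Rᵐᵒᵖ X]

/-- Left multiplication by `r` on `X`, as a map of right modules. -/
def lmul (r : R) : X →ₗ[Rᵐᵒᵖ] X where
  toFun x := r • x
  map_add' x y := smul_add r x y
  map_smul' s x := smul_comm r s x

/-- The right multiplication on `Hom_{R^op}(X, Y)`, given by `(f r)(x) = f (r x)`. -/
instance : SMul Rᵐᵒᵖ (RHom R X Y) where
  smul r f := (equiv R X Y).symm ((equiv R X Y f).comp (lmul R X (unop r)))

theorem smul_apply (r : Rᵐᵒᵖ) (f : RHom R X Y) (x : X) :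
    equiv R X Y (r • f) x = equiv R X Y f (unop r • x) := rfl

instance : Module Rᵐᵒᵖ (RHom R X Y) where
  one_smul f := ext fun x => by rw [smul_apply, unop_one, one_smul]
  mul_smul r s f := ext fun x => by
    rw [smul_apply, smul_apply, smul_apply, unop_mul, mul_smul]
  smul_zero r := ext fun x => by rw [smul_apply, map_zero, LinearMap.zero_apply,
    LinearMap.zero_apply]
  smul_add r f g := ext fun x => by
    rw [smul_apply, map_add, map_add, LinearMap.add_apply, LinearMap.add_apply, smul_apply,
      smul_apply]
  add_smul r s f := ext fun x => by
    rw [smul_apply, map_add, LinearMap.add_apply, smul_apply, smul_apply, MulOpposite.unop_add,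
      add_smul, map_add]
  zero_smul f := ext fun x => by
    rw [smul_apply, unop_zero, zero_smul, map_zero, map_zero, LinearMap.zero_apply]

end RHom

end RHom

/-! ### Right modules over the tensor ring -/

/-- The forgetful functor `U : Mod(T_R(M)^op) ⥤ Mod(R^op)`. -/
abbrev forgetful : ModuleCat.{u} (TensorRing R M)ᵐᵒᵖ ⥤ ModuleCat.{u} Rᵐᵒᵖ :=
  ModuleCat.restrictScalars (TensorRing.incl R M).op

/-- The functor `Coind = Hom_{R^op}(T_R(M), -)`, right adjoint to the forgetful functor. -/
abbrev coind : ModuleCat.{u} Rᵐᵒᵖ ⥤ ModuleCat.{u} (TensorRing R M)ᵐᵒᵖ :=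
  ModuleCat.coextendScalars (TensorRing.incl R M).op

variable {R M} in
/-- The `R^op`-linear map `v : Y → Hom_{R^op}(M, Y)`, `v(y)(m) = y m`, of a right
`T_R(M)`-module, which is thereby viewed as the pair `[Y, v]`. -/
def structureMap (Y : ModuleCat.{u} (TensorRing R M)ᵐᵒᵖ) :
    (forgetful R M).obj Y →ₗ[Rᵐᵒᵖ] RHom R M ((forgetful R M).obj Y) where
  toFun y := (RHom.equiv R M ((forgetful R M).obj Y)).symm
    { toFun := fun m => (op (TensorRing.gen R M m) • (y : Y) : Y)
      map_add' := fun m m' => by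
        rw [map_add, MulOpposite.op_add]
        exact add_smul (op (TensorRing.gen R M m)) (op (TensorRing.gen R M m')) (y : Y)
      map_smul' := fun r m => by
        have h := TensorRing.gen_op_smul R M (unop r) m
        rw [op_unop] at h
        rw [h, op_mul]
        exact mul_smul (op (TensorRing.incl R M (unop r))) (op (TensorRing.gen R M m)) (y : Y) }
  map_add' y y' := RHom.ext fun m => smul_add (op (TensorRing.gen R M m)) (y : Y) (y' : Y)
  map_smul' r y := RHom.ext fun m => by
    change op (TensorRing.gen R M m) • (op (TensorRing.incl R M (unop r)) • (y : Y)) =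
      op (TensorRing.gen R M (unop r • m)) • (y : Y)
    rw [TensorRing.gen_smul, op_mul, mul_smul]

variable {R M} in
theorem structureMap_apply (Y : ModuleCat.{u} (TensorRing R M)ᵐᵒᵖ) (y : Y) (m : M) :
    RHom.equiv R M ((forgetful R M).obj Y) (structureMap Y y) m =
      (op (TensorRing.gen R M m) • y : Y) := rfl

/-! ### Gorenstein injective modules -/

section Gorenstein

variable {A : Type u} [Ring A]

/-- The complex of abelian groups `Hom_A(E, I)` is exact. -/
def HomExact (E : ModuleCat.{u} A) (I : CochainComplex (ModuleCat.{u} A) ℤ) : Prop :=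
  (((preadditiveCoyoneda.obj (Opposite.op E)).mapHomologicalComplex _).obj I).Acyclic

/-- An exact complex of injective modules which stays exact under `Hom_A(E, -)` for every
injective module `E`. -/
structure IsCompleteInjectiveResolution (I : CochainComplex (ModuleCat.{u} A) ℤ) : Prop where
  exact : I.Acyclic
  injective : ∀ n, Injective (I.X n)
  homExact : ∀ E : ModuleCat.{u} A, Injective E → HomExact E I

variable (A) in
/-- The class of Gorenstein injective `A`-modules. -/
def gorensteinInjective : ObjectProperty (ModuleCat.{u} A) := fun X =>
  ∃ I : CochainComplex (ModuleCat.{u} A) ℤ,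
    IsCompleteInjectiveResolution I ∧ Nonempty (X ≅ Limits.kernel (I.d 0 1))

end Gorenstein

/-! ### Co-compatible and co-admissible bimodules, and the class `Ψ` -/

/-- The `R`-bimodule `X` is co-compatible (relative to the tensor ring `T_R(M)`). -/
structure IsCoCompatible (X : Type u) [AddCommGroup X] [Module R X] [Module Rᵐᵒᵖ X]
    [SMulCommClass R Rᵐᵒᵖ X] : Prop where
  exact_hom : ∀ I : CochainComplex (ModuleCat.{u} (TensorRing R M)ᵐᵒᵖ) ℤ,
    IsCompleteInjectiveResolution I →
      HomExact (ModuleCat.of Rᵐᵒᵖ X) (((forgetful R M).mapHomologicalComplex _).obj I)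
  exact_hom_coind : ∀ I : CochainComplex (ModuleCat.{u} (TensorRing R M)ᵐᵒᵖ) ℤ,
    IsCompleteInjectiveResolution I → ∀ E : ModuleCat.{u} Rᵐᵒᵖ, Injective E →
      HomExact ((coind R M).obj (ModuleCat.of Rᵐᵒᵖ (RHom R X E))) I

/-- The `R`-bimodule `X` is co-admissible. -/
structure IsCoAdmissible (X : Type u) [AddCommGroup X] [Module R X] [Module Rᵐᵒᵖ X]
    [SMulCommClass R Rᵐᵒᵖ X] : Prop where
  ext_hom_injective : ∀ H E : ModuleCat.{u} Rᵐᵒᵖ, gorensteinInjective Rᵐᵒᵖ H → Injective E →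
    ∀ i : ℕ, Subsingleton (Abelian.Ext.{u} (ModuleCat.of Rᵐᵒᵖ (RHom R (TPow R X i) E)) H 1)
  ext_hom_gorenstein : ∀ H : ModuleCat.{u} Rᵐᵒᵖ, gorensteinInjective Rᵐᵒᵖ H →
    ∀ i : ℕ, Subsingleton
      (Abelian.Ext.{u} (ModuleCat.of Rᵐᵒᵖ X) (ModuleCat.of Rᵐᵒᵖ (RHom R (TPow R X i) H)) 1)

/-- The class `Ψ(𝒴)` of right `T_R(M)`-modules `[Y, v]` with `v` an epimorphism and
`ker v` in `𝒴`. -/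
def Psi (𝒴 : ObjectProperty (ModuleCat.{u} Rᵐᵒᵖ)) :
    ObjectProperty (ModuleCat.{u} (TensorRing R M)ᵐᵒᵖ) := fun Y =>
  Function.Surjective (structureMap Y) ∧
    𝒴 (ModuleCat.of Rᵐᵒᵖ (LinearMap.ker (structureMap Y)))

end TensorRings

end

noncomputable section

namespace TensorRings

section

/-! ### First extension groups -/

section Ext

variable {A : Type u} [Ring A]

/-! Write `soc Y` for `ker v`, the elements of `Y` killed by `M`; on it `T` acts through the
augmentation `T → R`, so `soc` is right adjoint to `X ↦ [X, 0]`. Both directions compare short exact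
sequences of `T`-modules with their socles. The snake lemma for `v : Y → Hom(M, Y)` shows that `soc`
keeps a short exact sequence exact when the kernel term has surjective structure map. Moreover `soc
(Coind E) ≅ E`, `Coind E` has surjective structure map, and every injective `T`-module is a summand
of some `Coind E` with `E` injective.

Suppose `Y` is Gorenstein injective, a cycle module of a complete injective resolution `I`.
Exactness of `Hom(M, I)` lifts maps from `M` to cycles, so all cycles have surjective structure map,
and `soc I` is an exact complex of injectives whose cycles are the socles of the cycles of `I`. It
stays exact under `Hom(E, -)` because `Hom(E, soc I) = Hom([E, 0], I)` and the sequence `0 → [E, 0]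
→ Coind E → Coind Hom(M, E) → 0` reduces this to co-compatibility (`homExact_triv`).

Conversely, a class of modules is Gorenstein injective as soon as each member continues by an
injective to the right and to the left within the class and injectives have no `Ext¹` into it
(`gorensteinInjective_of_class`). For `Ψ` and `H = soc Y`: - right (`Psi_succ`): embed `H` in an
injective `E` with Gorenstein injective cokernel, extend to `Y → E`, and take the adjoint map `Y →
Coind E`. Nilpotency makes it injective. Its cokernel has surjective structure map since `Ext¹(M, Y)
= 0`, by the filtration of `Y` with factors `Hom(M^{⊗ k}, H)`. - `Ext¹(Coind E, Y) = 0`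
(`ext_coind_subsingleton`): iterate the sequence above until `Coind Hom(M^{⊗ (N+1)}, E) = 0`. - left
(`Psi_pred`): cover `H` by an injective `E` with Gorenstein injective kernel and extend `[E, 0] → Y`
to `Coind E → Y`, which nilpotency and co-admissibility make surjective. -/

theorem shortExact_mk {X Y Z : ModuleCat.{u} A} (f : X ⟶ Y) (g : Y ⟶ Z)
    (hf : Function.Injective f) (hg : Function.Surjective g) (hfg : Function.Exact f g) :
    ∃ w : f ≫ g = 0, (ShortComplex.mk f g w).ShortExact := by
  have w : f ≫ g = 0 := by
    ext x
    exact hfg.apply_apply_eq_zero x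
  refine ⟨w, ?_⟩
  have hm := (ModuleCat.mono_iff_injective f).2 hf
  have he := (ModuleCat.epi_iff_surjective g).2 hg
  exact { exact := (ShortComplex.ShortExact.moduleCat_exact_iff_function_exact _).2 hfg
          mono_f := hm, epi_g := he }

variable {S : ShortComplex (ModuleCat.{u} A)}

theorem exists_lift_of_ext (hS : S.ShortExact) {X : ModuleCat.{u} A}
    (h : Subsingleton (Abelian.Ext.{u} X S.X₁ 1)) (f : X ⟶ S.X₃) : ∃ g : X ⟶ S.X₂, g ≫ S.g = f := by
  obtain ⟨x, hx⟩ := Abelian.Ext.covariant_sequence_exact₃ X hS (Abelian.Ext.mk₀ f) (zero_add 1)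
    (Subsingleton.elim _ _)
  obtain ⟨g, rfl⟩ := Abelian.Ext.homEquiv₀.symm.surjective x
  refine ⟨g, Abelian.Ext.homEquiv₀.symm.injective ?_⟩
  simpa [Abelian.Ext.mk₀_comp_mk₀] using! hx

theorem exists_extension_of_ext (hS : S.ShortExact) {Y : ModuleCat.{u} A}
    (h : Subsingleton (Abelian.Ext.{u} S.X₃ Y 1)) (f : S.X₁ ⟶ Y) :
    ∃ g : S.X₂ ⟶ Y, S.f ≫ g = f := by
  obtain ⟨x, hx⟩ := Abelian.Ext.contravariant_sequence_exact₁ hS Y (Abelian.Ext.mk₀ f) (add_zero 1)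
    (Subsingleton.elim _ _)
  obtain ⟨g, rfl⟩ := Abelian.Ext.homEquiv₀.symm.surjective x
  refine ⟨g, Abelian.Ext.homEquiv₀.symm.injective ?_⟩
  simpa [Abelian.Ext.mk₀_comp_mk₀] using! hx

/-- With `S.X₂` injective, the long exact sequence makes `Ext¹(X, S.X₁)` the cokernel of `Hom(X,
S.X₂) → Hom(X, S.X₃)`. This turns lifting properties into vanishing of `Ext¹`. -/
theorem ext_subsingleton_of_lift (hS : S.ShortExact) (hI : Injective S.X₂) {X : ModuleCat.{u} A}
    (h : ∀ f : X ⟶ S.X₃, ∃ g : X ⟶ S.X₂, g ≫ S.g = f) :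
    Subsingleton (Abelian.Ext.{u} X S.X₁ 1) := by
  refine subsingleton_of_forall_eq 0 fun x => ?_
  obtain ⟨y, rfl⟩ := Abelian.Ext.covariant_sequence_exact₁ X hS x
    (Abelian.Ext.eq_zero_of_injective _) (zero_add 1)
  obtain ⟨f, rfl⟩ := Abelian.Ext.homEquiv₀.symm.surjective y
  obtain ⟨g, rfl⟩ := h f
  change (Abelian.Ext.mk₀ (g ≫ S.g)).comp hS.extClass _ = 0
  rw [← Abelian.Ext.mk₀_comp_mk₀, Abelian.Ext.comp_assoc_of_second_deg_zero, hS.comp_extClass,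
    Abelian.Ext.comp_zero]

theorem ext_subsingleton_middle_left (hS : S.ShortExact) {Y : ModuleCat.{u} A}
    (h₁ : Subsingleton (Abelian.Ext.{u} S.X₁ Y 1)) (h₃ : Subsingleton (Abelian.Ext.{u} S.X₃ Y 1)) :
    Subsingleton (Abelian.Ext.{u} S.X₂ Y 1) := by
  refine subsingleton_of_forall_eq 0 fun x => ?_
  obtain ⟨y, rfl⟩ := Abelian.Ext.contravariant_sequence_exact₂ hS Y x (Subsingleton.elim _ _)
  rw [Subsingleton.elim y 0, Abelian.Ext.comp_zero]

theorem ext_subsingleton_middle_right (hS : S.ShortExact) {X : ModuleCat.{u} A}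
    (h₁ : Subsingleton (Abelian.Ext.{u} X S.X₁ 1)) (h₃ : Subsingleton (Abelian.Ext.{u} X S.X₃ 1)) :
    Subsingleton (Abelian.Ext.{u} X S.X₂ 1) := by
  refine subsingleton_of_forall_eq 0 fun x => ?_
  obtain ⟨y, rfl⟩ := Abelian.Ext.covariant_sequence_exact₂ X hS x (Subsingleton.elim _ _)
  rw [Subsingleton.elim y 0, Abelian.Ext.zero_comp]

theorem ext_subsingleton_of_retract {X X' Y : ModuleCat.{u} A} (s : X ⟶ X') (r : X' ⟶ X)
    (hsr : s ≫ r = 𝟙 X) (h : Subsingleton (Abelian.Ext.{u} X' Y 1)) :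
    Subsingleton (Abelian.Ext.{u} X Y 1) := by
  refine subsingleton_of_forall_eq 0 fun x => ?_
  rw [← Abelian.Ext.mk₀_id_comp x, ← hsr, ← Abelian.Ext.mk₀_comp_mk₀_assoc,
    Subsingleton.elim ((Abelian.Ext.mk₀ r).comp x _) 0, Abelian.Ext.comp_zero]

theorem ext_subsingleton_of_iso_right {X Y Y' : ModuleCat.{u} A} (e : Y ≅ Y')
    (h : Subsingleton (Abelian.Ext.{u} X Y 1)) : Subsingleton (Abelian.Ext.{u} X Y' 1) := by
  refine subsingleton_of_forall_eq 0 fun x => ?_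
  have : x = (x.comp (Abelian.Ext.mk₀ e.inv) (add_zero 1)).comp (Abelian.Ext.mk₀ e.hom)
      (add_zero 1) := by
    rw [Abelian.Ext.comp_assoc_of_third_deg_zero, Abelian.Ext.mk₀_comp_mk₀, e.inv_hom_id,
      Abelian.Ext.comp_mk₀_id]
  rw [this, Subsingleton.elim (x.comp _ _) 0, Abelian.Ext.zero_comp]

end Ext

/-! ### Complete injective resolutions and splicing -/

section Splice

variable {A : Type u} [Ring A]

/-- Degrees are written `n`, `n + 1`, `n + 1 + 1` so that no subtraction enters the types of the
differentials. -/
theorem acyclic_iff (I : CochainComplex (ModuleCat.{u} A) ℤ) :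
    I.Acyclic ↔ ∀ n : ℤ, ∀ x : I.X (n + 1), I.d (n + 1) (n + 1 + 1) x = 0 →
      ∃ y : I.X n, I.d n (n + 1) y = x := by
  constructor
  · intro h n
    have := (I.exactAt_iff' n (n + 1) (n + 1 + 1) (by simp) (by simp)).1 (h (n + 1))
    exact (ShortComplex.moduleCat_exact_iff _).1 this
  · intro h j
    obtain ⟨n, rfl⟩ : ∃ n, j = n + 1 := ⟨j - 1, by ring⟩
    exact (I.exactAt_iff' n (n + 1) (n + 1 + 1) (by simp) (by simp)).2
      ((ShortComplex.moduleCat_exact_iff _).2 (h n))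

theorem homExact_iff (E : ModuleCat.{u} A) (I : CochainComplex (ModuleCat.{u} A) ℤ) :
    HomExact E I ↔ ∀ n : ℤ, ∀ f : E ⟶ I.X (n + 1), f ≫ I.d (n + 1) (n + 1 + 1) = 0 →
      ∃ g : E ⟶ I.X n, g ≫ I.d n (n + 1) = f := by
  constructor
  · intro h n
    have := (HomologicalComplex.exactAt_iff' _ n (n + 1) (n + 1 + 1) (by simp) (by simp)).1
      (h (n + 1))
    exact (ShortComplex.ab_exact_iff _).1 this
  · intro h j
    obtain ⟨n, rfl⟩ : ∃ n, j = n + 1 := ⟨j - 1, by ring⟩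
    exact (HomologicalComplex.exactAt_iff' _ n (n + 1) (n + 1 + 1) (by simp) (by simp)).2
      ((ShortComplex.ab_exact_iff _).2 (h n))

/-- A relation in which every element of a class has a successor and a predecessor in the class
has a bi-infinite chain through every element of the class. -/
theorem exists_int_chain {α : Type*} (P : α → Prop) (r : α → α → Prop)
    (succ : ∀ x, P x → ∃ y, P y ∧ r x y) (pred : ∀ x, P x → ∃ y, P y ∧ r y x) (x : α) (hx : P x) :
    ∃ s : ℤ → α, s 0 = x ∧ (∀ n, P (s n)) ∧ ∀ n, r (s n) (s (n + 1)) := by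
  choose f hf hrf using succ
  choose g hg hrg using pred
  let a : ℕ → {x // P x} := fun n => Nat.rec ⟨x, hx⟩ (fun _ y => ⟨f y.1 y.2, hf y.1 y.2⟩) n
  let b : ℕ → {x // P x} := fun n => Nat.rec ⟨x, hx⟩ (fun _ y => ⟨g y.1 y.2, hg y.1 y.2⟩) n
  -- `-(k + 1)` is sent to `b (k + 1)`. Both `a 0` and `b 0` are the starting point, which joins the
  -- two halves between `-1` and `0`.
  let s : ℤ → {x // P x} := fun n => Int.casesOn n (fun k => a k) (fun k => b (k + 1))
  refine ⟨fun n => (s n).1, rfl, fun n => (s n).2, fun n => ?_⟩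
  cases n with
  | ofNat k => exact hrf (a k).1 (a k).2
  | negSucc k =>
    cases k with
    | zero => exact hrg (b 0).1 (b 0).2
    | succ k =>
      have : Int.negSucc (k + 1) + 1 = Int.negSucc k := by omega
      rw [this]
      exact hrg (b (k + 1)).1 (b (k + 1)).2

/-- `X` is the kernel and `Z` the cokernel in a short exact sequence with injective middle term. -/
def InjectiveStep (X Z : ModuleCat.{u} A) : Prop :=
  ∃ (E : ModuleCat.{u} A) (f : X ⟶ E) (g : E ⟶ Z), Injective E ∧ Function.Injective f ∧
    Function.Surjective g ∧ Function.Exact f g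

/-- Splice the steps into a complex whose cycles are members of the class. The vanishing of `Ext¹`
from injectives says exactly that each spliced sequence stays exact under `Hom(E, -)`. -/
theorem gorensteinInjective_of_class (P : ObjectProperty (ModuleCat.{u} A))
    (succ : ∀ X, P X → ∃ Z, P Z ∧ InjectiveStep X Z)
    (pred : ∀ X, P X → ∃ Z, P Z ∧ InjectiveStep Z X)
    (ext : ∀ X E, P X → Injective E → Subsingleton (Abelian.Ext.{u} E X 1)) :
    ∀ X, P X → gorensteinInjective A X := by
  intro X hX
  obtain ⟨s, rfl, hs, hr⟩ := exists_int_chain P InjectiveStep succ pred X hX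
  choose E f g hE hf hg hfg using hr
  have hd : ∀ n, (g n ≫ f (n + 1)) ≫ (g (n + 1) ≫ f (n + 1 + 1)) = 0 := by
    intro n
    ext x
    change f (n + 1 + 1) (g (n + 1) (f (n + 1) (g n x))) = 0
    rw [(hfg (n + 1)).apply_apply_eq_zero, map_zero]
  let I : CochainComplex (ModuleCat.{u} A) ℤ := CochainComplex.of E (fun n => g n ≫ f (n + 1)) hd
  have hI : ∀ n, I.d n (n + 1) = g n ≫ f (n + 1) := fun n =>
    CochainComplex.of_d E (fun n => g n ≫ f (n + 1)) n
  have hses := fun n => shortExact_mk (f n) (g n) (hf n) (hg n) (hfg n)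
  refine ⟨I, ⟨?_, hE, ?_⟩, ?_⟩
  · rw [acyclic_iff]
    intro n x hx
    rw [hI] at hx ⊢
    have hx' : f (n + 1 + 1) (g (n + 1) x) = 0 := hx
    rw [map_eq_zero_iff _ (hf _)] at hx'
    obtain ⟨y, rfl⟩ := (hfg (n + 1) x).1 hx'
    obtain ⟨z, rfl⟩ := hg n y
    exact ⟨z, rfl⟩
  · intro E' hE'
    rw [homExact_iff]
    intro n φ hφ
    rw [hI] at hφ ⊢
    obtain ⟨w, hS⟩ := hses (n + 1)
    -- Cancelling the monomorphism `f (n + 1 + 1)`, a cocycle factors through `s (n + 1)`; it then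
    -- lifts along `g n`, whose kernel `s n` lies in the class.
    have := (ModuleCat.mono_iff_injective (f (n + 1 + 1))).2 (hf _)
    rw [← Category.assoc] at hφ
    have hφ' := Limits.zero_of_comp_mono _ hφ
    have := hS.mono_f
    obtain ⟨ψ, hψ⟩ := hS.exact.lift' φ hφ'
    obtain ⟨w', hS'⟩ := hses n
    obtain ⟨χ, hχ⟩ := exists_lift_of_ext hS' (ext _ _ (hs n) hE') ψ
    refine ⟨χ, ?_⟩
    change χ ≫ g n = ψ at hχ
    rw [← Category.assoc, hχ]
    exact hψ
  · obtain ⟨w, hS⟩ := hses 0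
    have := hS.mono_f
    have hm := (ModuleCat.mono_iff_injective (f (0 + 1))).2 (hf _)
    have h0 : I.d 0 1 = g 0 ≫ f (0 + 1) := hI 0
    exact ⟨(hS.exact.fIsKernel.conePointUniqueUpToIso (Limits.kernelIsKernel (g 0))) ≪≫
      (Limits.kernelCompMono (g 0) (f (0 + 1))).symm ≪≫ Limits.kernelIsoOfEq h0.symm⟩

theorem InjectiveStep.of_iso {X X' Z Z' : ModuleCat.{u} A} (h : InjectiveStep X Z) (e : X ≅ X')
    (e' : Z ≅ Z') : InjectiveStep X' Z' := by
  obtain ⟨E, f, g, hE, hf, hg, hfg⟩ := h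
  refine ⟨E, e.inv ≫ f, g ≫ e'.hom, hE, ?_, ?_, ?_⟩
  · exact hf.comp e.symm.toLinearEquiv.injective
  · exact e'.toLinearEquiv.surjective.comp hg
  · intro x
    change e'.toLinearEquiv (g x) = 0 ↔ x ∈ Set.range (f ∘ e.symm.toLinearEquiv)
    rw [e.symm.toLinearEquiv.surjective.range_comp, map_eq_zero_iff _ e'.toLinearEquiv.injective]
    exact hfg x

/-- The module of cycles of a complex in degree `n`. -/
def cycleModule (I : CochainComplex (ModuleCat.{u} A) ℤ) (n : ℤ) : ModuleCat.{u} A :=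
  ModuleCat.of A (LinearMap.ker (I.d n (n + 1)).hom)

/-- The inclusion of the cycles. -/
def cycleIncl (I : CochainComplex (ModuleCat.{u} A) ℤ) (n : ℤ) : cycleModule I n ⟶ I.X n :=
  ModuleCat.ofHom (Submodule.subtype _)

/-- The differential, as a map to the cycles. -/
def cycleProj (I : CochainComplex (ModuleCat.{u} A) ℤ) (n : ℤ) : I.X n ⟶ cycleModule I (n + 1) :=
  ModuleCat.ofHom ((I.d n (n + 1)).hom.codRestrict _ fun x => by
    rw [LinearMap.mem_ker, ← LinearMap.comp_apply, ← ModuleCat.hom_comp, I.d_comp_d,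
      ModuleCat.hom_zero, LinearMap.zero_apply])

theorem cycleProj_comp_incl (I : CochainComplex (ModuleCat.{u} A) ℤ) (n : ℤ) :
    cycleProj I n ≫ cycleIncl I (n + 1) = I.d n (n + 1) := rfl

theorem cycleIncl_injective (I : CochainComplex (ModuleCat.{u} A) ℤ) (n : ℤ) :
    Function.Injective (cycleIncl I n) := Subtype.val_injective

theorem cycleProj_surjective {I : CochainComplex (ModuleCat.{u} A) ℤ} (hI : I.Acyclic) (n : ℤ) :
    Function.Surjective (cycleProj I n) := by
  rintro ⟨x, hx⟩
  obtain ⟨y, hy⟩ := (acyclic_iff I).1 hI n x hx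
  exact ⟨y, Subtype.ext hy⟩

theorem cycle_exact (I : CochainComplex (ModuleCat.{u} A) ℤ) (n : ℤ) :
    Function.Exact (cycleIncl I n) (cycleProj I n) := by
  intro x
  refine ⟨fun h => ⟨⟨x, congrArg Subtype.val h⟩, rfl⟩, ?_⟩
  rintro ⟨y, rfl⟩
  exact Subtype.ext y.2

/-- The cycles of a complex, as a kernel in the category of modules. -/
def cycleIso (I : CochainComplex (ModuleCat.{u} A) ℤ) :
    cycleModule I 0 ≅ Limits.kernel (I.d 0 1) :=
  (ModuleCat.kernelIsoKer (I.d 0 1)).symm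

theorem IsCompleteInjectiveResolution.injectiveStep {I : CochainComplex (ModuleCat.{u} A) ℤ}
    (hI : IsCompleteInjectiveResolution I) (n : ℤ) :
    InjectiveStep (cycleModule I n) (cycleModule I (n + 1)) :=
  ⟨I.X n, cycleIncl I n, cycleProj I n, hI.injective n, cycleIncl_injective I n,
    cycleProj_surjective hI.exact n, cycle_exact I n⟩

theorem IsCompleteInjectiveResolution.exists_lift {I : CochainComplex (ModuleCat.{u} A) ℤ}
    {E : ModuleCat.{u} A} (hE : HomExact E I) (n : ℤ) (f : E ⟶ cycleModule I (n + 1)) :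
    ∃ g : E ⟶ I.X n, g ≫ cycleProj I n = f := by
  obtain ⟨g, hg⟩ := (homExact_iff E I).1 hE n (f ≫ cycleIncl I (n + 1)) (by
    ext x
    exact (f x).2)
  have := (ModuleCat.mono_iff_injective _).2 (cycleIncl_injective I (n + 1))
  refine ⟨g, ?_⟩
  rw [← cancel_mono (cycleIncl I (n + 1)), Category.assoc, cycleProj_comp_incl, hg]

/-- The definition only mentions degree `0`. Applying the criterion to the class of all cycles of
`I` covers the other degrees without shifting the complex. -/
theorem gorensteinInjective_cycleModule {I : CochainComplex (ModuleCat.{u} A) ℤ}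
    (hI : IsCompleteInjectiveResolution I) (n : ℤ) :
    gorensteinInjective A (cycleModule I n) := by
  refine gorensteinInjective_of_class (fun X => ∃ n, X = cycleModule I n) ?_ ?_ ?_ _ ⟨n, rfl⟩
  · rintro _ ⟨n, rfl⟩
    exact ⟨_, ⟨n + 1, rfl⟩, hI.injectiveStep n⟩
  · rintro _ ⟨n, rfl⟩
    refine ⟨_, ⟨n - 1, rfl⟩, ?_⟩
    have := hI.injectiveStep (n - 1)
    rwa [sub_add_cancel] at this
  · rintro _ E ⟨n, rfl⟩ hE
    obtain ⟨w, hS⟩ := shortExact_mk _ _ (cycleIncl_injective I n)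
      (cycleProj_surjective hI.exact n) (cycle_exact I n)
    exact ext_subsingleton_of_lift hS (hI.injective n)
      (IsCompleteInjectiveResolution.exists_lift (hI.homExact E hE) n)

theorem gorensteinInjective_of_iso {X Y : ModuleCat.{u} A} (e : X ≅ Y)
    (h : gorensteinInjective A X) : gorensteinInjective A Y := by
  obtain ⟨I, hI, ⟨i⟩⟩ := h
  exact ⟨I, hI, ⟨e.symm ≪≫ i⟩⟩

theorem gorensteinInjective_succ {X : ModuleCat.{u} A} (h : gorensteinInjective A X) :
    ∃ Z, gorensteinInjective A Z ∧ InjectiveStep X Z := by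
  obtain ⟨I, hI, ⟨i⟩⟩ := h
  exact ⟨_, gorensteinInjective_cycleModule hI (0 + 1),
    (hI.injectiveStep 0).of_iso (cycleIso I ≪≫ i.symm) (Iso.refl _)⟩

theorem gorensteinInjective_pred {X : ModuleCat.{u} A} (h : gorensteinInjective A X) :
    ∃ Z, gorensteinInjective A Z ∧ InjectiveStep Z X := by
  obtain ⟨I, hI, ⟨i⟩⟩ := h
  exact ⟨_, gorensteinInjective_cycleModule hI (-1),
    (hI.injectiveStep (-1)).of_iso (Iso.refl _) (cycleIso I ≪≫ i.symm)⟩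

end Splice

end

section

/-! ### The grading and the augmentation of the tensor ring -/

namespace TensorRing

variable (R : Type u) [Ring R]
variable (M : Type u) [AddCommGroup M] [Module R M] [Module Rᵐᵒᵖ M] [SMulCommClass R Rᵐᵒᵖ M]

theorem gen_mul_of (m : M) (i : ℕ) (x : TPow R M i) :
    gen R M m * of R M i x = of R M (i + 1) (TPow.cons R M i m x) := by
  rw [gen_mul, shift_of]

theorem of_mul_incl (i : ℕ) (x : TPow R M i) (r : R) :
    of R M i x * incl R M r = of R M i (op r • x) := by
  induction i with
  | zero =>
    obtain ⟨s, rfl⟩ := (TPow.scalar R M).surjective x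
    rw [← incl_apply, ← map_mul, incl_apply, TPow.op_smul_scalar]
  | succ i ih =>
    refine TPow.succ_induction x ?_ (fun m y => ?_) (fun y z hy hz => ?_)
    · rw [smul_zero, map_zero, zero_mul]
    · rw [← gen_mul_of, mul_assoc, ih, gen_mul_of, TPow.op_smul_cons]
    · rw [smul_add, map_add, map_add, add_mul, hy, hz]

theorem incl_mul_of (i : ℕ) (r : R) (x : TPow R M i) :
    incl R M r * of R M i x = of R M i (r • x) := by
  rw [incl_mul, smul_of]

/-- The degree is `j + i`, not `i + j`, so that it agrees by computation with the recursion on the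
left factor: `j + 0 = j` and `j + (i + 1) = (j + i) + 1`. -/
theorem exists_of_mul_of (i j : ℕ) (x : TPow R M i) (y : TPow R M j) :
    ∃ z : TPow R M (j + i), of R M i x * of R M j y = of R M (j + i) z := by
  induction i with
  | zero =>
    obtain ⟨r, rfl⟩ := (TPow.scalar R M).surjective x
    exact ⟨r • y, by rw [← incl_apply, incl_mul_of]; rfl⟩
  | succ i ih =>
    refine TPow.succ_induction x ?_ (fun m x => ?_) (fun x x' hx hx' => ?_)
    · exact ⟨0, by rw [map_zero, map_zero, zero_mul]⟩
    · obtain ⟨z, hz⟩ := ih x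
      exact ⟨TPow.cons R M _ m z, by rw [← gen_mul_of, mul_assoc, hz, gen_mul_of]; rfl⟩
    · obtain ⟨z, hz⟩ := hx
      obtain ⟨z', hz'⟩ := hx'
      exact ⟨z + z', by rw [map_add, add_mul, hz, hz', map_add]⟩

variable {R M} in
/-- The component of degree `i + 1` is additively generated by the products `x m` with `x` of
degree `i` and `m` in `M`. -/
@[elab_as_elim]
theorem of_succ_induction {i : ℕ} {p : TensorRing R M → Prop} (x : TPow R M (i + 1))
    (zero : p 0) (mul_gen : ∀ (y : TPow R M i) m, p (of R M i y * gen R M m))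
    (add : ∀ s t, p s → p t → p (s + t)) : p (of R M (i + 1) x) := by
  induction i generalizing p with
  | zero =>
    refine TPow.succ_induction x ?_ (fun m y => ?_) (fun y z hy hz => ?_)
    · rwa [map_zero]
    · obtain ⟨r, rfl⟩ := (TPow.scalar R M).surjective y
      -- In degree one, `m ⊗ r = m r ⊗ 1 = 1 · (m r)`.
      have := mul_gen (TPow.scalar R M 1) (op r • m)
      rwa [← incl_apply, map_one, one_mul, gen_op_smul, incl_apply, gen_mul_of] at this
    · rw [map_add]
      exact add _ _ hy hz
  | succ i ih =>
    refine TPow.succ_induction x ?_ (fun m y => ?_) (fun y z hy hz => ?_)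
    · rwa [map_zero]
    · rw [← gen_mul_of]
      -- Tensor powers grow on the left, while a factor has to be split off on the right; left
      -- multiplication by `m` preserves such products, as `m (z m') = (m z) m'`.
      refine ih (p := fun t => p (gen R M m * t)) y ?_ (fun z m' => ?_) (fun s t hs ht => ?_)
      · rwa [mul_zero]
      · rw [← mul_assoc, gen_mul_of]
        exact mul_gen _ _
      · rw [mul_add]
        exact add _ _ hs ht
    · rw [map_add]
      exact add _ _ hy hz

/-- The projection to the component of degree `0`, as an additive map. -/
def augmentationHom : TensorRing R M →+ R :=
  toAdd R M fun i => match i with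
    | 0 => (TPow.scalar R M).symm.toAddMonoidHom
    | _ + 1 => 0

theorem augmentationHom_scalar (r : R) :
    augmentationHom R M (of R M 0 (TPow.scalar R M r)) = r := by
  rw [augmentationHom, toAdd_of]
  rfl

theorem augmentationHom_succ (i : ℕ) (x : TPow R M (i + 1)) :
    augmentationHom R M (of R M (i + 1) x) = 0 := by
  rw [augmentationHom, toAdd_of]
  rfl

/-- The augmentation `T_R(M) → R`, with kernel the ideal of elements of positive degree. -/
def augmentation : TensorRing R M →+* R where
  __ := augmentationHom R M
  map_one' := augmentationHom_scalar R M 1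
  map_mul' s t := by
    change augmentationHom R M (s * t) = augmentationHom R M s * augmentationHom R M t
    refine induction_on s ?_ (fun i x => ?_) (fun x y hx hy => ?_)
    · rw [zero_mul, map_zero, zero_mul]
    · refine induction_on t ?_ (fun j y => ?_) (fun x y hx hy => ?_)
      · rw [mul_zero, map_zero, mul_zero]
      · cases j with
        | zero =>
          obtain ⟨r, rfl⟩ := (TPow.scalar R M).surjective y
          rw [← incl_apply, of_mul_incl, incl_apply, augmentationHom_scalar]
          cases i with
          | zero =>
            obtain ⟨s, rfl⟩ := (TPow.scalar R M).surjective x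
            rw [TPow.op_smul_scalar, augmentationHom_scalar, augmentationHom_scalar]
          | succ i => rw [augmentationHom_succ, augmentationHom_succ, zero_mul]
        | succ j =>
          rw [augmentationHom_succ, mul_zero]
          obtain ⟨z, hz⟩ := exists_of_mul_of R M i (j + 1) x y
          rw [hz]
          -- The degree `j + 1 + i` of `z` has to be rewritten as a successor, and it occurs in the
          -- type of `z`.
          revert z
          rw [add_right_comm]
          exact fun z _ => augmentationHom_succ R M _ z
      · rw [mul_add, map_add, map_add, mul_add, hx, hy]
    · rw [add_mul, map_add, map_add, add_mul, hx, hy]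

theorem augmentation_incl (r : R) : augmentation R M (incl R M r) = r :=
  augmentationHom_scalar R M r

theorem augmentation_of_succ (i : ℕ) (x : TPow R M (i + 1)) :
    augmentation R M (of R M (i + 1) x) = 0 := augmentationHom_succ R M i x

theorem augmentation_gen (m : M) : augmentation R M (gen R M m) = 0 :=
  augmentationHom_succ R M 0 _

end TensorRing

/-! ### Functoriality and currying for `Hom_{R^op}(X, Y)` -/

namespace RHom

variable (R : Type u) [Ring R]

section Map

variable (X : Type u) [AddCommGroup X] [Module Rᵐᵒᵖ X] [Module R X] [SMulCommClass R Rᵐᵒᵖ X]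
variable {Y Y' : Type u} [AddCommGroup Y'] [Module Rᵐᵒᵖ Y'] [AddCommGroup Y] [Module Rᵐᵒᵖ Y]

/-- Composition with a linear map. -/
def map (f : Y →ₗ[Rᵐᵒᵖ] Y') : RHom R X Y →ₗ[Rᵐᵒᵖ] RHom R X Y' where
  toFun g := (equiv R X Y').symm (f.comp (equiv R X Y g))
  map_add' g h := ext fun x => map_add f (equiv R X Y g x) (equiv R X Y h x)
  map_smul' _ _ := rfl

theorem map_apply (f : Y →ₗ[Rᵐᵒᵖ] Y') (g : RHom R X Y) (x : X) :
    equiv R X Y' (map R X f g) x = f (equiv R X Y g x) := rfl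

theorem map_injective {f : Y →ₗ[Rᵐᵒᵖ] Y'} (hf : Function.Injective f) :
    Function.Injective (map R X f) := fun _ _ h =>
  ext fun x => hf (congrArg (fun g => equiv R X Y' g x) h)

theorem map_exact {Y'' : Type u} [AddCommGroup Y''] [Module Rᵐᵒᵖ Y''] {f : Y →ₗ[Rᵐᵒᵖ] Y'}
    {g : Y' →ₗ[Rᵐᵒᵖ] Y''} (hf : Function.Injective f) (hfg : Function.Exact f g) :
    Function.Exact (map R X f) (map R X g) := by
  intro h
  constructor
  · intro h0
    -- The chosen preimages are unique because `f` is injective, hence they depend linearly on `x`.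
    have hx : ∀ x, ∃ y, f y = equiv R X Y' h x := fun x =>
      (hfg _).1 (congrArg (fun k => equiv R X Y'' k x) h0)
    choose k hk using hx
    refine ⟨(equiv R X Y).symm { toFun := k, map_add' := ?_, map_smul' := ?_ }, ext hk⟩
    · intro x y
      apply hf
      rw [map_add, hk, hk, hk, map_add]
    · intro r x
      apply hf
      rw [map_smul, hk, hk, map_smul]
      rfl
  · rintro ⟨k, rfl⟩
    exact ext fun x => hfg.apply_apply_eq_zero _

/-- Composition with a linear equivalence. -/
def mapEquiv (e : Y ≃ₗ[Rᵐᵒᵖ] Y') : RHom R X Y ≃ₗ[Rᵐᵒᵖ] RHom R X Y' :=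
  LinearEquiv.ofLinearMap (map R X e.toLinearMap) (map R X e.symm.toLinearMap)
    (LinearMap.ext fun f => ext fun x => e.apply_symm_apply (equiv R X Y' f x))
    (LinearMap.ext fun f => ext fun x => e.symm_apply_apply (equiv R X Y f x))

end Map

variable (M : Type u) [AddCommGroup M] [Module R M] [Module Rᵐᵒᵖ M] [SMulCommClass R Rᵐᵒᵖ M]
variable (Y : Type u) [AddCommGroup Y] [Module Rᵐᵒᵖ Y]

/-- `Hom_{R^op}(R, Y) = Y`. -/
def scalarEquiv : Y ≃ₗ[Rᵐᵒᵖ] RHom R (TPow R M 0) Y where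
  toFun y := (equiv R (TPow R M 0) Y).symm
    { toFun := fun x => op ((TPow.scalar R M).symm x) • y
      map_add' := fun x x' => by rw [map_add, MulOpposite.op_add, add_smul]
      map_smul' := fun r x => by
        obtain ⟨s, rfl⟩ := (TPow.scalar R M).surjective x
        rw [← op_unop r, TPow.op_smul_scalar, AddEquiv.symm_apply_apply,
          AddEquiv.symm_apply_apply, op_mul, mul_smul, RingHom.id_apply] }
  invFun f := equiv R (TPow R M 0) Y f (TPow.scalar R M 1)
  map_add' y y' := ext fun x => smul_add _ y y'
  map_smul' r y := ext fun x => by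
    obtain ⟨s, rfl⟩ := (TPow.scalar R M).surjective x
    change op ((TPow.scalar R M).symm (TPow.scalar R M s)) • r • y =
      op ((TPow.scalar R M).symm (unop r • TPow.scalar R M s)) • y
    rw [TPow.smul_scalar, AddEquiv.symm_apply_apply, AddEquiv.symm_apply_apply, op_mul, op_unop,
      mul_smul]
  left_inv y := by
    change op ((TPow.scalar R M).symm (TPow.scalar R M 1)) • y = y
    rw [AddEquiv.symm_apply_apply, op_one, one_smul]
  right_inv f := ext fun x => by
    obtain ⟨s, rfl⟩ := (TPow.scalar R M).surjective x
    change op ((TPow.scalar R M).symm (TPow.scalar R M s)) •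
      equiv R (TPow R M 0) Y f (TPow.scalar R M 1) = _
    rw [AddEquiv.symm_apply_apply, ← map_smul, TPow.op_smul_scalar, one_mul]

/-- The map `m ↦ x ↦ f (m ⊗ x)`. -/
def curryFun (i : ℕ) (f : RHom R (TPow R M (i + 1)) Y) : RHom R M (RHom R (TPow R M i) Y) :=
  (equiv R M _).symm
    { toFun := fun m => (equiv R (TPow R M i) Y).symm
        { toFun := fun x => equiv R (TPow R M (i + 1)) Y f (TPow.cons R M i m x)
          map_add' := fun x x' => by rw [map_add, map_add]
          map_smul' := fun r x => by
            rw [← TPow.op_smul_cons, map_smul, RingHom.id_apply] }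
      map_add' := fun m m' => ext fun x => by
        change equiv R (TPow R M (i + 1)) Y f (TPow.cons R M i (m + m') x) =
          equiv R (TPow R M (i + 1)) Y f (TPow.cons R M i m x) +
          equiv R (TPow R M (i + 1)) Y f (TPow.cons R M i m' x)
        rw [map_add, AddMonoidHom.add_apply, map_add]
      map_smul' := fun r m => ext fun x => by
        change equiv R (TPow R M (i + 1)) Y f (TPow.cons R M i (r • m) x) =
          equiv R (TPow R M (i + 1)) Y f (TPow.cons R M i m (unop r • x))
        rw [← TPow.cons_op_smul, op_unop] }

theorem curryFun_apply (i : ℕ) (f : RHom R (TPow R M (i + 1)) Y) (m : M) (x : TPow R M i) :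
    equiv R (TPow R M i) Y (equiv R M _ (curryFun R M Y i f) m) x =
      equiv R (TPow R M (i + 1)) Y f (TPow.cons R M i m x) := rfl

/-- The additive map `m ⊗ x ↦ f m x`. -/
def uncurryHom (i : ℕ) (f : RHom R M (RHom R (TPow R M i) Y)) : TPow R M (i + 1) →+ Y :=
  TPow.succLift R M i
    { toFun := fun m => (equiv R (TPow R M i) Y (equiv R M _ f m)).toAddMonoidHom
      map_zero' := by rw [map_zero, map_zero]; rfl
      map_add' := fun m m' => by rw [map_add, map_add]; rfl }
    (fun r m x => by
      change equiv R (TPow R M i) Y (equiv R M _ f (op r • m)) x =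
        equiv R (TPow R M i) Y (equiv R M _ f m) (r • x)
      rw [map_smul]
      rfl)

theorem uncurryHom_cons (i : ℕ) (f : RHom R M (RHom R (TPow R M i) Y)) (m : M) (x : TPow R M i) :
    uncurryHom R M Y i f (TPow.cons R M i m x) =
      equiv R (TPow R M i) Y (equiv R M _ f m) x := rfl

/-- The map `m ⊗ x ↦ f m x`. -/
def uncurryFun (i : ℕ) (f : RHom R M (RHom R (TPow R M i) Y)) : RHom R (TPow R M (i + 1)) Y :=
  (equiv R (TPow R M (i + 1)) Y).symm
    { toFun := uncurryHom R M Y i f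
      map_add' := fun x y => map_add _ x y
      map_smul' := fun r x => by
        rw [RingHom.id_apply]
        refine TPow.succ_induction x ?_ (fun m y => ?_) (fun y z hy hz => ?_)
        · rw [smul_zero, map_zero, smul_zero]
        · rw [TPow.op_smul_cons, uncurryHom_cons, uncurryHom_cons, map_smul]
        · rw [smul_add, map_add, map_add, smul_add, hy, hz] }

theorem uncurryFun_cons (i : ℕ) (f : RHom R M (RHom R (TPow R M i) Y)) (m : M) (x : TPow R M i) :
    equiv R (TPow R M (i + 1)) Y (uncurryFun R M Y i f) (TPow.cons R M i m x) =
      equiv R (TPow R M i) Y (equiv R M _ f m) x := uncurryHom_cons R M Y i f m x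

variable {R M Y} in
theorem succ_ext {i : ℕ} {f g : RHom R (TPow R M (i + 1)) Y}
    (h : ∀ m x, equiv R (TPow R M (i + 1)) Y f (TPow.cons R M i m x) =
      equiv R (TPow R M (i + 1)) Y g (TPow.cons R M i m x)) : f = g :=
  ext fun x => by
    refine TPow.succ_induction x ?_ h (fun y z hy hz => ?_)
    · rw [map_zero, map_zero]
    · rw [map_add, map_add, hy, hz]

/-- `Hom_{R^op}(M ⊗_R M^{⊗ i}, Y) = Hom_{R^op}(M, Hom_{R^op}(M^{⊗ i}, Y))`. -/
def curry (i : ℕ) : RHom R (TPow R M (i + 1)) Y ≃ₗ[Rᵐᵒᵖ] RHom R M (RHom R (TPow R M i) Y) where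
  toFun := curryFun R M Y i
  invFun := uncurryFun R M Y i
  map_add' _ _ := rfl
  map_smul' r f := ext fun m => ext fun x => by
    rw [RingHom.id_apply, curryFun_apply, smul_apply, smul_apply, curryFun_apply, TPow.smul_cons]
  left_inv f := succ_ext fun m x => by rw [uncurryFun_cons, curryFun_apply]
  right_inv f := ext fun m => ext fun x => by rw [curryFun_apply, uncurryFun_cons]

theorem curry_apply (i : ℕ) (f : RHom R (TPow R M (i + 1)) Y) (m : M) (x : TPow R M i) :
    equiv R (TPow R M i) Y (equiv R M _ (curry R M Y i f) m) x =
      equiv R (TPow R M (i + 1)) Y f (TPow.cons R M i m x) := rfl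

theorem curry_symm_cons (i : ℕ) (f : RHom R M (RHom R (TPow R M i) Y)) (m : M) (x : TPow R M i) :
    equiv R (TPow R M (i + 1)) Y ((curry R M Y i).symm f) (TPow.cons R M i m x) =
      equiv R (TPow R M i) Y (equiv R M _ f m) x := uncurryFun_cons R M Y i f m x

/-- The map `Hom_{R^op}(M^{⊗ i}, Hom_{R^op}(M, Y)) → Hom_{R^op}(M^{⊗ (i+1)}, Y)` which sends `f` to
`x m ↦ f x m`. -/
def snocLift : ∀ i : ℕ, RHom R (TPow R M i) (RHom R M Y) →ₗ[Rᵐᵒᵖ] RHom R (TPow R M (i + 1)) Y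
  | 0 => (curry R M Y 0).symm.toLinearMap ∘ₗ map R M (scalarEquiv R M Y).toLinearMap ∘ₗ
      (scalarEquiv R M (RHom R M Y)).symm.toLinearMap
  | i + 1 => (curry R M Y (i + 1)).symm.toLinearMap ∘ₗ map R M (snocLift i) ∘ₗ
      (curry R M (RHom R M Y) i).toLinearMap

theorem snocLift_zero_cons (f : RHom R (TPow R M 0) (RHom R M Y)) (m : M) (r : R) :
    equiv R (TPow R M 1) Y (snocLift R M Y 0 f) (TPow.cons R M 0 m (TPow.scalar R M r)) =
      equiv R M Y (equiv R (TPow R M 0) _ f (TPow.scalar R M 1)) (op r • m) := by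
  refine (curry_symm_cons R M Y 0 _ _ _).trans ?_
  rw [map_smul]
  rfl

theorem snocLift_succ_cons (i : ℕ) (f : RHom R (TPow R M (i + 1)) (RHom R M Y)) (m : M)
    (x : TPow R M (i + 1)) :
    equiv R (TPow R M (i + 2)) Y (snocLift R M Y (i + 1) f) (TPow.cons R M (i + 1) m x) =
      equiv R (TPow R M (i + 1)) Y (snocLift R M Y i
        (equiv R M _ (curry R M (RHom R M Y) i f) m)) x :=
  curry_symm_cons R M Y (i + 1) _ _ _

/-- This ties `snocLift` to the ring multiplication. Since powers are built by adding factors on the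
left, `x ⊗ m` is only available as some `z` representing the product `x m`; the same `z` must serve
both identities. -/
theorem snocLift_of_mul_gen (i : ℕ) (f : RHom R (TPow R M i) (RHom R M Y)) (x : TPow R M i)
    (m : M) : ∃ z : TPow R M (i + 1),
      TensorRing.of R M i x * TensorRing.gen R M m = TensorRing.of R M (i + 1) z ∧
      equiv R (TPow R M (i + 1)) Y (snocLift R M Y i f) z =
        equiv R M Y (equiv R (TPow R M i) _ f x) m := by
  induction i with
  | zero =>
    obtain ⟨s, rfl⟩ := (TPow.scalar R M).surjective x
    refine ⟨TPow.cons R M 0 (s • m) (TPow.scalar R M 1), ?_, ?_⟩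
    · rw [← TensorRing.incl_apply, ← TensorRing.gen_smul, TensorRing.gen_apply]
    · have hs : TPow.scalar R M s = op s • TPow.scalar R M 1 := by
        rw [TPow.op_smul_scalar, one_mul]
      rw [snocLift_zero_cons, op_one, one_smul, hs,
        (equiv R (TPow R M 0) (RHom R M Y) f).map_smul, smul_apply, unop_op]
  | succ i ih =>
    refine TPow.succ_induction x ?_ (fun m' y => ?_) (fun y y' hy hy' => ?_)
    · exact ⟨0, by rw [map_zero, map_zero, zero_mul],
        by rw [map_zero, map_zero, map_zero, LinearMap.zero_apply]⟩
    · obtain ⟨z, hz, hz'⟩ := ih (equiv R M _ (curry R M (RHom R M Y) i f) m') y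
      refine ⟨TPow.cons R M (i + 1) m' z, ?_, ?_⟩
      · rw [← TensorRing.gen_mul_of, mul_assoc, hz, TensorRing.gen_mul_of]
      · rw [snocLift_succ_cons, hz', curry_apply]
    · obtain ⟨z, hz, hz'⟩ := hy
      obtain ⟨w, hw, hw'⟩ := hy'
      refine ⟨z + w, ?_, ?_⟩
      · rw [map_add, add_mul, hz, hw, map_add]
      · rw [map_add, hz', hw', map_add, map_add, LinearMap.add_apply]

end RHom

end

section

variable {R : Type u} [Ring R]
variable {M : Type u} [AddCommGroup M] [Module R M] [Module Rᵐᵒᵖ M] [SMulCommClass R Rᵐᵒᵖ M]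

/-! ### The kernel of the structure map -/

variable (R M) in
/-- The identification of a right `T_R(M)`-module with its underlying right `R`-module. -/
def res (Y : ModuleCat.{u} (TensorRing R M)ᵐᵒᵖ) : Y ≃+ (forgetful R M).obj Y := AddEquiv.refl _

theorem op_smul_res (Y : ModuleCat.{u} (TensorRing R M)ᵐᵒᵖ) (r : R) (y : Y) :
    op r • res R M Y y = res R M Y (op (TensorRing.incl R M r) • y) := rfl

theorem structureMap_res (Y : ModuleCat.{u} (TensorRing R M)ᵐᵒᵖ) (y : Y) (m : M) :
    RHom.equiv R M _ (structureMap Y (res R M Y y)) m =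
      res R M Y (op (TensorRing.gen R M m) • y) := rfl

/-- The kernel of the structure map of a right `T_R(M)`-module, as a right `R`-module. -/
abbrev soc (Y : ModuleCat.{u} (TensorRing R M)ᵐᵒᵖ) : ModuleCat.{u} Rᵐᵒᵖ :=
  ModuleCat.of Rᵐᵒᵖ (LinearMap.ker (structureMap Y))

namespace soc

variable {Y Z : ModuleCat.{u} (TensorRing R M)ᵐᵒᵖ}

/-- The inclusion of the kernel of the structure map. -/
def incl (Y : ModuleCat.{u} (TensorRing R M)ᵐᵒᵖ) : soc Y →+ Y :=
  (res R M Y).symm.toAddMonoidHom.comp (Submodule.subtype _).toAddMonoidHom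

theorem incl_injective : Function.Injective (incl Y) :=
  (res R M Y).symm.injective.comp Subtype.val_injective

theorem incl_op_smul (r : R) (y : soc Y) :
    incl Y (op r • y) = op (TensorRing.incl R M r) • incl Y y := rfl

theorem gen_smul_incl (y : soc Y) (m : M) : op (TensorRing.gen R M m) • incl Y y = 0 :=
  (res R M Y).injective (congrArg (fun f => RHom.equiv R M _ f m) (LinearMap.mem_ker.1 y.2))

/-- The element of the kernel of the structure map given by an element annihilated by `M`. -/
def mk (y : Y) (hy : ∀ m : M, op (TensorRing.gen R M m) • y = 0) : soc Y :=
  ⟨res R M Y y, LinearMap.mem_ker.2 (RHom.ext fun m => by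
    rw [structureMap_res, hy, map_zero, map_zero, LinearMap.zero_apply])⟩

theorem incl_mk (y : Y) (hy : ∀ m : M, op (TensorRing.gen R M m) • y = 0) :
    incl Y (mk y hy) = y := rfl

theorem structureMap_eq_zero_iff (y : Y) : structureMap Y (res R M Y y) = 0 ↔
    ∀ m : M, op (TensorRing.gen R M m) • y = 0 :=
  ⟨fun h m => gen_smul_incl ⟨res R M Y y, LinearMap.mem_ker.2 h⟩ m,
    fun h => LinearMap.mem_ker.1 (mk y h).2⟩

/-- In a right module `y (m ⊗ x) = (y m) x`, so an element killed by `M` is killed by everything of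
positive degree. -/
theorem smul_incl (y : soc Y) (t : TensorRing R M) :
    op t • incl Y y =
      op (TensorRing.incl R M (TensorRing.augmentation R M t)) • incl Y y := by
  refine TensorRing.induction_on t ?_ (fun i x => ?_) (fun s t hs ht => ?_)
  · rw [map_zero, map_zero]
  · cases i with
    | zero =>
      obtain ⟨r, rfl⟩ := (TPow.scalar R M).surjective x
      rw [← TensorRing.incl_apply, TensorRing.augmentation_incl]
    | succ i =>
      rw [TensorRing.augmentation_of_succ, map_zero, MulOpposite.op_zero, zero_smul]
      refine TPow.succ_induction x ?_ (fun m y => ?_) (fun y z hy hz => ?_)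
      · rw [map_zero, MulOpposite.op_zero, zero_smul]
      · rw [← TensorRing.gen_mul_of, op_mul, mul_smul, gen_smul_incl, smul_zero]
      · rw [map_add, MulOpposite.op_add, add_smul, hy, hz, add_zero]
  · rw [map_add, map_add, MulOpposite.op_add, MulOpposite.op_add, add_smul, add_smul, hs, ht]

end soc

variable {Y Z W : ModuleCat.{u} (TensorRing R M)ᵐᵒᵖ}

theorem map_res (f : Y ⟶ Z) (y : Y) : (forgetful R M).map f (res R M Y y) = res R M Z (f y) := rfl

theorem structureMap_naturality (f : Y ⟶ Z) (y : Y) :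
    structureMap Z (res R M Z (f y)) =
      RHom.map R M ((forgetful R M).map f).hom (structureMap Y (res R M Y y)) :=
  RHom.ext fun m => by
    rw [structureMap_res, ← map_smul, ← map_res]
    rfl

/-- The map induced on the kernels of the structure maps. -/
def socMap (f : Y ⟶ Z) : soc Y ⟶ soc Z :=
  ModuleCat.ofHom
    ((((forgetful R M).map f).hom.comp (Submodule.subtype _)).codRestrict _ fun y => by
      rw [LinearMap.mem_ker]
      refine (structureMap_naturality f (soc.incl Y y)).trans ?_
      refine (congrArg _ (LinearMap.mem_ker.1 y.2)).trans (map_zero _))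

theorem incl_socMap (f : Y ⟶ Z) (y : soc Y) : soc.incl Z (socMap f y) = f (soc.incl Y y) := rfl

theorem socMap_injective {f : Y ⟶ Z} (hf : Function.Injective f) :
    Function.Injective (socMap f) := fun x y h =>
  soc.incl_injective (hf (by rw [← incl_socMap, ← incl_socMap, h]))

theorem socMap_exact {f : Y ⟶ Z} {g : Z ⟶ W}
    (hf : Function.Injective f) (hfg : Function.Exact f g) :
    Function.Exact (socMap f) (socMap g) := by
  intro z
  constructor
  · intro h
    obtain ⟨y, hy⟩ := (hfg (soc.incl Z z)).1 (by rw [← incl_socMap, h, map_zero])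
    refine ⟨soc.mk y fun m => hf ?_, soc.incl_injective ?_⟩
    · rw [map_zero, map_smul, hy, soc.gen_smul_incl]
    · rw [incl_socMap, soc.incl_mk, hy]
  · rintro ⟨y, rfl⟩
    apply soc.incl_injective
    rw [incl_socMap, incl_socMap, hfg.apply_apply_eq_zero, map_zero]

theorem forgetful_exact {f : Y ⟶ Z} {g : Z ⟶ W} (hfg : Function.Exact f g) :
    Function.Exact ((forgetful R M).map f) ((forgetful R M).map g) := hfg

theorem forgetful_injective {f : Y ⟶ Z} (hf : Function.Injective f) :
    Function.Injective ((forgetful R M).map f) := hf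

theorem forgetful_surjective {f : Y ⟶ Z} (hf : Function.Surjective f) :
    Function.Surjective ((forgetful R M).map f) := hf

theorem exists_structureMap_eq (hY : Function.Surjective (structureMap Y))
    (φ : RHom R M ((forgetful R M).obj Y)) : ∃ y : Y, structureMap Y (res R M Y y) = φ := by
  obtain ⟨y, hy⟩ := hY φ
  exact ⟨(res R M Y).symm y, hy⟩

theorem structureMap_surjective_iff : Function.Surjective (structureMap Y) ↔
    ∀ φ, ∃ y : Y, structureMap Y (res R M Y y) = φ :=
  ⟨exists_structureMap_eq, fun h φ => (h φ).imp' (res R M Y) fun _ hy => hy⟩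

/-- Snake lemma for the structure maps: the connecting map from `soc W` lands in the cokernel of the
structure map of `Y`, which is zero. -/
theorem socMap_surjective {f : Y ⟶ Z} {g : Z ⟶ W}
    (hf : Function.Injective f) (hg : Function.Surjective g) (hfg : Function.Exact f g)
    (hY : Function.Surjective (structureMap Y)) : Function.Surjective (socMap g) := by
  intro w
  obtain ⟨z, hz⟩ := hg (soc.incl W w)
  obtain ⟨φ, hφ⟩ := (RHom.map_exact R M (forgetful_injective hf) (forgetful_exact hfg)
    (structureMap Z (res R M Z z))).1 (by
      refine (structureMap_naturality g z).symm.trans ?_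
      rw [hz]
      exact LinearMap.mem_ker.1 w.2)
  obtain ⟨y, rfl⟩ := exists_structureMap_eq hY φ
  have hs : structureMap Z (res R M Z (z - f y)) = 0 := by
    rw [map_sub, map_sub, structureMap_naturality f, sub_eq_zero]
    exact hφ.symm
  refine ⟨soc.mk (z - f y) ((soc.structureMap_eq_zero_iff _).1 hs), soc.incl_injective ?_⟩
  rw [incl_socMap, soc.incl_mk, map_sub, hfg.apply_apply_eq_zero, sub_zero, hz]

/-- In a short exact sequence, the structure map of the kernel is surjective if the structure map
of the middle term is surjective and the map of kernels of structure maps is surjective. -/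
theorem structureMap_surjective_of_socMap {f : Y ⟶ Z}
    {g : Z ⟶ W} (hf : Function.Injective f) (hfg : Function.Exact f g)
    (hZ : Function.Surjective (structureMap Z)) (hg : Function.Surjective (socMap g)) :
    Function.Surjective (structureMap Y) := by
  rw [structureMap_surjective_iff]
  intro φ
  obtain ⟨z, hz⟩ := exists_structureMap_eq hZ (RHom.map R M ((forgetful R M).map f).hom φ)
  have hgz : structureMap W (res R M W (g z)) = 0 := by
    rw [structureMap_naturality g, hz]
    exact RHom.ext fun m => (forgetful_exact hfg).apply_apply_eq_zero _
  -- Subtracting `s` moves `z` into the image of `Y` without changing its value under the structure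
  -- map.
  obtain ⟨s, hs⟩ := hg (soc.mk (g z) ((soc.structureMap_eq_zero_iff _).1 hgz))
  obtain ⟨y, hy⟩ := (hfg (z - soc.incl Z s)).1 (by
    rw [map_sub, ← incl_socMap, hs, soc.incl_mk, sub_self])
  refine ⟨y, RHom.map_injective R M (forgetful_injective hf) ?_⟩
  refine (structureMap_naturality f y).symm.trans ?_
  rw [hy, map_sub, map_sub, hz,
    (soc.structureMap_eq_zero_iff _).2 (soc.gen_smul_incl s), sub_zero]

/-- In a short exact sequence, the structure map of the cokernel is surjective if the structure map
of the middle term is surjective and maps from `M` to the cokernel lift to the middle term. -/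
theorem structureMap_surjective_of_lift {g : Z ⟶ W} (hZ : Function.Surjective (structureMap Z))
    (hg : Function.Surjective (RHom.map R M ((forgetful R M).map g).hom)) :
    Function.Surjective (structureMap W) := by
  rw [structureMap_surjective_iff]
  intro φ
  obtain ⟨ψ, rfl⟩ := hg φ
  obtain ⟨z, rfl⟩ := exists_structureMap_eq hZ ψ
  exact ⟨g z, structureMap_naturality g z⟩

/-! ### Modules with trivial action of the bimodule -/

variable (R M) in
/-- The functor `X ↦ [X, 0]`. -/
abbrev triv : ModuleCat.{u} Rᵐᵒᵖ ⥤ ModuleCat.{u} (TensorRing R M)ᵐᵒᵖ :=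
  ModuleCat.restrictScalars (TensorRing.augmentation R M).op

variable (R M) in
/-- The identification of `X` with the underlying group of `[X, 0]`. -/
def toTriv (X : ModuleCat.{u} Rᵐᵒᵖ) : X ≃+ (triv R M).obj X := AddEquiv.refl _

theorem smul_toTriv (X : ModuleCat.{u} Rᵐᵒᵖ) (t : TensorRing R M) (x : X) :
    op t • toTriv R M X x = toTriv R M X (op (TensorRing.augmentation R M t) • x) := rfl

/-- The linear map `[X, 0] → Y` given by a map of `R`-modules to the kernel of the structure
map. -/
def trivLinearMap {X : ModuleCat.{u} Rᵐᵒᵖ} (f : X ⟶ soc Y) :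
    (triv R M).obj X →ₗ[(TensorRing R M)ᵐᵒᵖ] Y where
  toFun x := soc.incl Y (f ((toTriv R M X).symm x))
  map_add' x y := by rw [map_add, map_add, map_add]
  map_smul' t x := by
    obtain ⟨x, rfl⟩ := (toTriv R M X).surjective x
    obtain ⟨t, rfl⟩ := op_surjective t
    rw [smul_toTriv, AddEquiv.symm_apply_apply, AddEquiv.symm_apply_apply, map_smul,
      soc.incl_op_smul, RingHom.id_apply, soc.smul_incl _ t]

/-- The map of `T_R(M)`-modules `[X, 0] → Y` given by a map of `R`-modules to the kernel of the
structure map. -/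
def trivLift {X : ModuleCat.{u} Rᵐᵒᵖ} (f : X ⟶ soc Y) : (triv R M).obj X ⟶ Y :=
  ModuleCat.ofHom (X := (triv R M).obj X) (trivLinearMap f)

/-- The map of `R`-modules to the kernel of the structure map of `Y` given by a map `[X, 0] → Y` of
`T_R(M)`-modules. -/
def trivDesc {X : ModuleCat.{u} Rᵐᵒᵖ} (f : (triv R M).obj X ⟶ Y) : X ⟶ soc Y :=
  ModuleCat.ofHom
    { toFun := fun x => soc.mk (f (toTriv R M X x)) fun m => by
        rw [← map_smul, smul_toTriv, TensorRing.augmentation_gen, MulOpposite.op_zero, zero_smul,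
          map_zero, map_zero]
      map_add' := fun x y => soc.incl_injective (by
        rw [(soc.incl Y).map_add, soc.incl_mk, soc.incl_mk, soc.incl_mk, map_add, map_add])
      map_smul' := fun r x => soc.incl_injective (by
        obtain ⟨r, rfl⟩ := op_surjective r
        rw [RingHom.id_apply, soc.incl_op_smul, soc.incl_mk, soc.incl_mk, ← map_smul, smul_toTriv,
          TensorRing.augmentation_incl]) }

theorem soc_hom_ext {X : ModuleCat.{u} Rᵐᵒᵖ} {f g : X ⟶ soc Y}
    (h : ∀ x, soc.incl Y (f x) = soc.incl Y (g x)) : f = g :=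
  ModuleCat.hom_ext (LinearMap.ext fun x => soc.incl_injective (h x))

/-! ### Coinduced modules -/

namespace Coind

variable {E : ModuleCat.{u} Rᵐᵒᵖ}

/-- The value of an element of `Hom_{R^op}(T_R(M), E)`. -/
def eval (j : (coind R M).obj E) : TensorRing R M →+ E where
  toFun t := ModuleCat.CoextendScalars.equiv _ E j (op t : (TensorRing R M)ᵐᵒᵖ)
  map_zero' := map_zero (ModuleCat.CoextendScalars.equiv _ E j)
  map_add' s t := map_add (ModuleCat.CoextendScalars.equiv _ E j) (op s : (TensorRing R M)ᵐᵒᵖ)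
    (op t : (TensorRing R M)ᵐᵒᵖ)

theorem eval_mul_incl (j : (coind R M).obj E) (t : TensorRing R M) (r : R) :
    eval j (t * TensorRing.incl R M r) = op r • eval j t :=
  (ModuleCat.CoextendScalars.equiv _ E j).map_smul (op r) (op t : (TensorRing R M)ᵐᵒᵖ)

theorem eval_smul (j : (coind R M).obj E) (s t : TensorRing R M) :
    eval (op s • j) t = eval j (s * t) := rfl

theorem eval_add (j k : (coind R M).obj E) (t : TensorRing R M) :
    eval (j + k) t = eval j t + eval k t := rfl

theorem ext {j k : (coind R M).obj E} (h : ∀ t, eval j t = eval k t) : j = k :=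
  ModuleCat.CoextendScalars.ext (LinearMap.ext fun t => h (unop t))

/-- The element of `Hom_{R^op}(T_R(M), E)` given by an additive map. -/
def mk (f : TensorRing R M →+ E) (hf : ∀ t r, f (t * TensorRing.incl R M r) = op r • f t) :
    (coind R M).obj E :=
  (ModuleCat.CoextendScalars.equiv _ E).symm
    { toFun := fun t => f (unop (t : (TensorRing R M)ᵐᵒᵖ))
      map_add' := fun s t => map_add f (unop (s : (TensorRing R M)ᵐᵒᵖ))
        (unop (t : (TensorRing R M)ᵐᵒᵖ))
      map_smul' := fun r t => hf (unop (t : (TensorRing R M)ᵐᵒᵖ)) (unop r) }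

theorem eval_mk (f : TensorRing R M →+ E)
    (hf : ∀ t r, f (t * TensorRing.incl R M r) = op r • f t) (t : TensorRing R M) :
    eval (mk f hf) t = f t := rfl

/-- The element of `Hom_{R^op}(T_R(M), E)` given by its restrictions to the components. -/
def ofComponents (f : ∀ i, TPow R M i →ₗ[Rᵐᵒᵖ] E) : (coind R M).obj E :=
  mk (TensorRing.toAdd R M fun i => (f i).toAddMonoidHom) (fun t r => by
    refine TensorRing.induction_on t ?_ (fun i x => ?_) (fun s t hs ht => ?_)
    · rw [zero_mul, map_zero, smul_zero]
    · rw [TensorRing.of_mul_incl, TensorRing.toAdd_of, TensorRing.toAdd_of]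
      exact (f i).map_smul (op r) x
    · rw [add_mul, map_add, map_add, smul_add, hs, ht])

theorem eval_ofComponents (f : ∀ i, TPow R M i →ₗ[Rᵐᵒᵖ] E) (i : ℕ) (x : TPow R M i) :
    eval (ofComponents f) (TensorRing.of R M i x) = f i x :=
  TensorRing.toAdd_of R M _ i x

/-- The map to a coinduced module given by a map of `R`-modules. -/
def lift (f : (forgetful R M).obj Y ⟶ E) : Y ⟶ (coind R M).obj E :=
  ModuleCat.RestrictionCoextensionAdj.HomEquiv.fromRestriction _ f

theorem eval_lift (f : (forgetful R M).obj Y ⟶ E) (y : Y) (t : TensorRing R M) :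
    eval (lift f y) t = f (res R M Y (op t • y)) := rfl

instance [Injective E] : Injective ((coind R M).obj E) :=
  Injective.injective_of_adjoint
    (ModuleCat.restrictCoextendScalarsAdj.{u} (TensorRing.incl R M).op) E

theorem eval_zero (t : TensorRing R M) : eval (0 : (coind R M).obj E) t = 0 := rfl

/-- The restriction `Hom_{R^op}(T_R(M), E) → Hom_{R^op}(M^{⊗ i}, E)`. -/
def component (E : ModuleCat.{u} Rᵐᵒᵖ) (i : ℕ) :
    (forgetful R M).obj ((coind R M).obj E) →ₗ[Rᵐᵒᵖ] RHom R (TPow R M i) E where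
  toFun j := (RHom.equiv R (TPow R M i) E).symm
    { toFun := fun x => eval ((res R M _).symm j) (TensorRing.of R M i x)
      map_add' := fun x y => by rw [map_add, map_add]
      map_smul' := fun r x => by
        obtain ⟨r, rfl⟩ := op_surjective r
        rw [← TensorRing.of_mul_incl, eval_mul_incl, RingHom.id_apply] }
  map_add' _ _ := rfl
  map_smul' r j := RHom.ext fun x => by
    obtain ⟨r, rfl⟩ := op_surjective r
    obtain ⟨j, rfl⟩ := (res R M _).surjective j
    change eval (op (TensorRing.incl R M r) • j) (TensorRing.of R M i x) =
      eval j (TensorRing.of R M i (r • x))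
    rw [eval_smul, TensorRing.incl_mul_of]

theorem component_apply (j : (coind R M).obj E) (i : ℕ) (x : TPow R M i) :
    RHom.equiv R (TPow R M i) E (component E i (res R M _ j)) x =
      eval j (TensorRing.of R M i x) := rfl

/-- The structure map of `Coind E` sends `j` to `m ↦ (t ↦ j (m t))`. A preimage of `φ` is therefore
prescribed in positive degrees by `j (m ⊗ x) = φ m x`, and its value in degree `0` is free; zero is
taken. -/
theorem structureMap_surjective : Function.Surjective (structureMap ((coind R M).obj E)) := by
  rw [structureMap_surjective_iff]
  intro φ
  refine ⟨ofComponents fun i => match i with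
    | 0 => 0
    | i + 1 => RHom.equiv R (TPow R M (i + 1)) E
        ((RHom.curry R M E i).symm (RHom.map R M (component E i) φ)), ?_⟩
  refine RHom.ext fun m => ?_
  obtain ⟨k, hk⟩ := (res R M _).surjective (RHom.equiv R M _ φ m)
  rw [structureMap_res, ← hk]
  congr 1
  refine ext fun t => ?_
  refine TensorRing.induction_on t ?_ (fun i x => ?_) (fun s t hs ht => ?_)
  · rw [map_zero, map_zero]
  · rw [eval_smul, TensorRing.gen_mul_of, eval_ofComponents]
    refine (RHom.curry_symm_cons R M E i _ m x).trans ?_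
    rw [RHom.map_apply, ← hk, component_apply]
  · rw [map_add, map_add, hs, ht]

theorem soc_eval (j : soc ((coind R M).obj E)) (t : TensorRing R M) :
    eval (soc.incl _ j) t = op (TensorRing.augmentation R M t) • eval (soc.incl _ j) 1 := by
  rw [← eval_mul_incl, one_mul, ← mul_one t, ← eval_smul, soc.smul_incl, eval_smul,
    mul_one, mul_one]

/-- Evaluation at `1` identifies the kernel of the structure map of a coinduced module. -/
def socEquiv (E : ModuleCat.{u} Rᵐᵒᵖ) : soc ((coind R M).obj E) ≃ₗ[Rᵐᵒᵖ] E where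
  toFun j := eval (soc.incl _ j) 1
  map_add' j k := by rw [map_add, eval_add]
  map_smul' r j := by
    obtain ⟨r, rfl⟩ := op_surjective r
    rw [soc.incl_op_smul, eval_smul, soc_eval, mul_one, TensorRing.augmentation_incl,
      RingHom.id_apply]
  invFun e := soc.mk
    (mk { toFun := fun t => op (TensorRing.augmentation R M t) • e
          map_zero' := by rw [map_zero, MulOpposite.op_zero, zero_smul]
          map_add' := fun s t => by rw [map_add, MulOpposite.op_add, add_smul] }
      fun t r => by
        change op (TensorRing.augmentation R M _) • e =
          op r • op (TensorRing.augmentation R M _) • e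
        rw [map_mul, TensorRing.augmentation_incl, op_mul, mul_smul])
    fun m => ext fun t => by
      rw [eval_smul, eval_mk, eval_zero]
      change op (TensorRing.augmentation R M _) • e = 0
      rw [map_mul, TensorRing.augmentation_gen, zero_mul, MulOpposite.op_zero, zero_smul]
  left_inv j := soc.incl_injective (ext fun t => by
    rw [soc.incl_mk, eval_mk]
    exact (soc_eval j t).symm)
  right_inv e := by
    change op (TensorRing.augmentation R M 1) • e = e
    rw [map_one, op_one, one_smul]

theorem socEquiv_apply (j : soc ((coind R M).obj E)) : socEquiv E j = eval (soc.incl _ j) 1 := rfl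

theorem eval_socEquiv_symm (e : E) (t : TensorRing R M) :
    eval (soc.incl _ ((socEquiv (M := M) E).symm e)) t = op (TensorRing.augmentation R M t) • e :=
  rfl

variable (R M E) in
/-- The embedding `[E, 0] → Hom_{R^op}(T_R(M), E)`. -/
def fromTriv : (triv R M).obj E ⟶ (coind R M).obj E :=
  trivLift (socEquiv E).symm.toModuleIso.hom

theorem fromTriv_apply (e : E) :
    fromTriv R M E (toTriv R M E e) = soc.incl _ ((socEquiv E).symm e) := rfl

theorem fromTriv_injective : Function.Injective (fromTriv R M E) :=
  soc.incl_injective.comp ((socEquiv E).symm.injective.comp (toTriv R M E).symm.injective)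

variable (R M E) in
/-- The map of `R`-modules `Hom_{R^op}(T_R(M), E) → Hom_{R^op}(M, E)` given by restriction. -/
def restrictGen : (forgetful R M).obj ((coind R M).obj E) ⟶ ModuleCat.of Rᵐᵒᵖ (RHom R M E) :=
  ModuleCat.ofHom (X := (forgetful R M).obj ((coind R M).obj E))
    { toFun := fun j => (RHom.equiv R M E).symm
        { toFun := fun m => eval ((res R M _).symm j) (TensorRing.gen R M m)
          map_add' := fun m m' => by rw [map_add, map_add]
          map_smul' := fun r m => by
            obtain ⟨r, rfl⟩ := op_surjective r
            rw [TensorRing.gen_op_smul, eval_mul_incl, RingHom.id_apply] }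
      map_add' := fun j k => RHom.ext fun m => rfl
      map_smul' := fun r j => RHom.ext fun m => by
        obtain ⟨r, rfl⟩ := op_surjective r
        obtain ⟨j, rfl⟩ := (res R M _).surjective j
        change eval (op (TensorRing.incl R M r) • j) (TensorRing.gen R M m) =
          eval j (TensorRing.gen R M (r • m))
        rw [eval_smul, TensorRing.gen_smul] }

variable (R M E) in
/-- The map `Hom_{R^op}(T_R(M), E) → Hom_{R^op}(T_R(M), Hom_{R^op}(M, E))` given by
`j ↦ t ↦ m ↦ j (t m)`. -/
def toCoindRHom : (coind R M).obj E ⟶ (coind R M).obj (ModuleCat.of Rᵐᵒᵖ (RHom R M E)) :=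
  lift (restrictGen R M E)

theorem eval_toCoindRHom (j : (coind R M).obj E) (t : TensorRing R M) (m : M) :
    RHom.equiv R M E (eval (toCoindRHom R M E j) t) m = eval j (t * TensorRing.gen R M m) := rfl

/-- A preimage of `χ` has to satisfy `j (x m) = χ x m`. This determines it in positive degrees,
where `snocLift` gives it; degree `0` is again free. -/
theorem toCoindRHom_surjective : Function.Surjective (toCoindRHom R M E) := by
  intro χ
  let f (i : ℕ) : RHom R (TPow R M i) (RHom R M E) := component _ i (res R M _ χ)
  let j : (coind R M).obj E := ofComponents fun i => match i with
    | 0 => 0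
    | i + 1 => RHom.equiv R (TPow R M (i + 1)) E (RHom.snocLift R M E i (f i))
  refine ⟨j, ext fun t => RHom.ext fun m => ?_⟩
  rw [eval_toCoindRHom]
  refine TensorRing.induction_on t ?_ (fun i x => ?_) (fun s t hs ht => ?_)
  · rw [zero_mul, map_zero, map_zero, map_zero, LinearMap.zero_apply]
  · obtain ⟨z, hz, hz'⟩ := RHom.snocLift_of_mul_gen R M E i (f i) x m
    rw [hz, eval_ofComponents]
    exact hz'
  · rw [add_mul, map_add, map_add, map_add, LinearMap.add_apply, hs, ht]

/-- An element `j` of the kernel vanishes on all products `t m`. These generate the positive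
degrees, so `j` is determined by `j 1`. -/
theorem fromTriv_exact : Function.Exact (fromTriv R M E) (toCoindRHom R M E) := by
  intro j
  constructor
  · intro h
    have h0 (t : TensorRing R M) (m : M) : eval j (t * TensorRing.gen R M m) = 0 := by
      rw [← eval_toCoindRHom, h]
      rfl
    refine ⟨toTriv R M E (eval j 1), ?_⟩
    rw [fromTriv_apply]
    refine ext fun t => ?_
    rw [eval_socEquiv_symm]
    refine TensorRing.induction_on t ?_ (fun i x => ?_) (fun s t hs ht => ?_)
    · rw [map_zero, map_zero, MulOpposite.op_zero, zero_smul]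
    · cases i with
      | zero =>
        obtain ⟨r, rfl⟩ := (TPow.scalar R M).surjective x
        rw [← TensorRing.incl_apply, TensorRing.augmentation_incl, ← eval_mul_incl, one_mul]
      | succ i =>
        rw [TensorRing.augmentation_of_succ, MulOpposite.op_zero, zero_smul]
        refine TensorRing.of_succ_induction (p := fun t => 0 = eval j t) x ?_
          (fun y m => (h0 _ m).symm) (fun s t hs ht => ?_)
        · rw [map_zero]
        · rw [map_add, ← hs, ← ht, add_zero]
    · rw [map_add, map_add, MulOpposite.op_add, add_smul, hs, ht]
  · rintro ⟨e, rfl⟩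
    obtain ⟨e, rfl⟩ := (toTriv R M E).surjective e
    refine ext fun t => RHom.ext fun m => ?_
    rw [eval_toCoindRHom, fromTriv_apply, eval_socEquiv_symm, map_mul, TensorRing.augmentation_gen,
      mul_zero, MulOpposite.op_zero, zero_smul]
    rfl

end Coind

end

section

variable {R : Type u} [Ring R]
variable {M : Type u} [AddCommGroup M] [Module R M] [Module Rᵐᵒᵖ M] [SMulCommClass R Rᵐᵒᵖ M]
variable {Y Z : ModuleCat.{u} (TensorRing R M)ᵐᵒᵖ}

/-! ### Injective modules over the tensor ring -/

theorem structureMap_surjective_of_retract (s : Y ⟶ Z) (r : Z ⟶ Y) (h : s ≫ r = 𝟙 Y)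
    (hZ : Function.Surjective (structureMap Z)) : Function.Surjective (structureMap Y) := by
  refine structureMap_surjective_of_lift (g := r) hZ fun φ =>
    ⟨RHom.map R M ((forgetful R M).map s).hom φ, RHom.ext fun m => ?_⟩
  rw [RHom.map_apply, RHom.map_apply, ← LinearMap.comp_apply, ← ModuleCat.hom_comp,
    ← Functor.map_comp, h,
    CategoryTheory.Functor.map_id, ModuleCat.hom_id, LinearMap.id_apply]

/-- An isomorphism induces an isomorphism of the kernels of the structure maps. -/
def socIso (e : Y ≅ Z) : soc Y ≅ soc Z where
  hom := socMap e.hom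
  inv := socMap e.inv
  hom_inv_id := by
    refine soc_hom_ext fun y => ?_
    change e.inv (e.hom (soc.incl Y y)) = soc.incl Y y
    rw [Iso.hom_inv_id_apply]
  inv_hom_id := by
    refine soc_hom_ext fun y => ?_
    change e.hom (e.inv (soc.incl Z y)) = soc.incl Z y
    rw [Iso.inv_hom_id_apply]

/-- An injective module over the tensor ring is a direct summand of a module coinduced from an
injective module. -/
theorem exists_retract_coind (I : ModuleCat.{u} (TensorRing R M)ᵐᵒᵖ) (hI : Injective I) :
    ∃ (E : ModuleCat.{u} Rᵐᵒᵖ) (s : I ⟶ (coind R M).obj E) (r : (coind R M).obj E ⟶ I),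
      Injective E ∧ s ≫ r = 𝟙 I := by
  let ι := Injective.ι ((forgetful R M).obj I)
  have hι : Function.Injective ι := (ModuleCat.mono_iff_injective ι).1 inferInstance
  have hs : Function.Injective (Coind.lift ι) := by
    intro x y h
    have := congrArg (fun j => Coind.eval j 1) h
    simp only [Coind.eval_lift, op_one, one_smul] at this
    exact (res R M I).injective (hι this)
  have := (ModuleCat.mono_iff_injective (Coind.lift ι)).2 hs
  exact ⟨_, Coind.lift ι, Injective.factorThru (𝟙 I) (Coind.lift ι), inferInstance,
    Injective.comp_factorThru _ _⟩

theorem structureMap_surjective_of_injective (I : ModuleCat.{u} (TensorRing R M)ᵐᵒᵖ)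
    (hI : Injective I) : Function.Surjective (structureMap I) := by
  obtain ⟨E, s, r, hE, hsr⟩ := exists_retract_coind I hI
  exact structureMap_surjective_of_retract s r hsr Coind.structureMap_surjective

/-- `soc` is right adjoint to `triv`, which preserves monomorphisms, so it preserves injectives; the
extension is obtained over the tensor ring and transported back. -/
theorem injective_soc (I : ModuleCat.{u} (TensorRing R M)ᵐᵒᵖ) (hI : Injective I) :
    Injective (soc I) where
  factors {X X'} g f hf := by
    refine ⟨trivDesc (Injective.factorThru (trivLift g) ((triv R M).map f)), ?_⟩
    refine soc_hom_ext fun x => ?_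
    exact DFunLike.congr_fun (ModuleCat.hom_ext_iff.1
      (Injective.comp_factorThru (trivLift g) ((triv R M).map f))) (toTriv R M X x)

theorem Psi_of_iso {P : ObjectProperty (ModuleCat.{u} Rᵐᵒᵖ)} (hP : ∀ X X', (X ≅ X') → P X → P X')
    (e : Y ≅ Z) (h : Psi R M P Y) : Psi R M P Z :=
  ⟨structureMap_surjective_of_retract e.inv e.hom e.inv_hom_id h.1, hP _ _ (socIso e) h.2⟩

/-! ### Gorenstein injective modules over the tensor ring lie in `Ψ` -/

section CoCompatible

variable {I : CochainComplex (ModuleCat.{u} (TensorRing R M)ᵐᵒᵖ) ℤ}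

/-- As the terms of `I` are injective, `0 → [E, 0] → Coind E → Coind Hom(M, E) → 0` induces a short
exact sequence of Hom complexes. Two of them are acyclic, hence so is the third; the proof is the
corresponding diagram chase. -/
theorem homExact_triv (hI : IsCompleteInjectiveResolution I) (E : ModuleCat.{u} Rᵐᵒᵖ)
    (hE : Injective E)
    (hcoind : HomExact ((coind R M).obj (ModuleCat.of Rᵐᵒᵖ (RHom R M E))) I) :
    HomExact ((triv R M).obj E) I := by
  rw [homExact_iff]
  intro n f hf
  obtain ⟨w, hS⟩ := shortExact_mk (Coind.fromTriv R M E) (Coind.toCoindRHom R M E)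
    Coind.fromTriv_injective Coind.toCoindRHom_surjective Coind.fromTriv_exact
  have hm := hS.mono_f
  have he := hS.epi_g
  have hIn := hI.injective (n + 1)
  let g : (coind R M).obj E ⟶ I.X (n + 1) := Injective.factorThru f (Coind.fromTriv R M E)
  have hg : Coind.fromTriv R M E ≫ g = f := Injective.comp_factorThru _ _
  -- The extension `g` of the cocycle `f` need not be a cocycle, but its differential vanishes on
  -- `[E, 0]` and so comes from a cocycle `h` on the quotient.
  obtain ⟨h, hh⟩ := hS.exact.desc' (g ≫ I.d (n + 1) (n + 1 + 1)) (by
    change Coind.fromTriv R M E ≫ g ≫ I.d (n + 1) (n + 1 + 1) = 0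
    rw [← Category.assoc, hg, hf])
  change Coind.toCoindRHom R M E ≫ h = _ at hh
  obtain ⟨k, hk⟩ := (homExact_iff _ I).1 hcoind (n + 1) h (by
    rw [← cancel_epi (Coind.toCoindRHom R M E), ← Category.assoc, hh, Category.assoc, I.d_comp_d,
      Limits.comp_zero, Limits.comp_zero])
  -- Correcting `g` by a map through the quotient makes it a cocycle and leaves its restriction `f`
  -- unchanged.
  obtain ⟨l, hl⟩ := (homExact_iff _ I).1 (hI.homExact ((coind R M).obj E) inferInstance) n
    (g - Coind.toCoindRHom R M E ≫ k) (by
      rw [Preadditive.sub_comp, Category.assoc, hk, hh, sub_self])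
  refine ⟨Coind.fromTriv R M E ≫ l, ?_⟩
  rw [Category.assoc, hl, Preadditive.comp_sub, hg, ← Category.assoc, w, Limits.zero_comp, sub_zero]

/-- Exactness of `Hom(M, I)` lifts each map from `M` to a cycle module to the preceding injective,
whose structure map is surjective. -/
theorem structureMap_cycleModule_surjective (hI : IsCompleteInjectiveResolution I)
    (hM : HomExact (ModuleCat.of Rᵐᵒᵖ M) (((forgetful R M).mapHomologicalComplex _).obj I))
    (n : ℤ) :
    Function.Surjective (structureMap (cycleModule I n)) := by
  obtain ⟨n, rfl⟩ : ∃ k, n = k + 1 := ⟨n - 1, by ring⟩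
  refine structureMap_surjective_of_lift (g := cycleProj I n)
    (structureMap_surjective_of_injective _ (hI.injective n)) fun φ => ?_
  obtain ⟨g, hg⟩ := (homExact_iff _ _).1 hM n
    (ModuleCat.ofHom (RHom.equiv R M _ φ) ≫ (forgetful R M).map (cycleIncl I (n + 1))) (by
      ext m
      exact (RHom.equiv R M _ φ m).2)
  refine ⟨(RHom.equiv R M _).symm g.hom, RHom.ext fun m => ?_⟩
  refine forgetful_injective (cycleIncl_injective I (n + 1)) ?_
  exact DFunLike.congr_fun (ModuleCat.hom_ext_iff.1 hg) m

/-- The socles of the cycles are linked by the injectives `soc (I.X n)`. Lifting a map from `E` to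
such a socle is, by adjunction, lifting a map from `[E, 0]` to a cycle module. -/
theorem gorensteinInjective_soc_cycleModule (hI : IsCompleteInjectiveResolution I)
    (hcomp : IsCoCompatible R M M) (n : ℤ) :
    gorensteinInjective Rᵐᵒᵖ (soc (cycleModule I n)) := by
  have hv := structureMap_cycleModule_surjective hI (hcomp.exact_hom I hI)
  have hsurj (n : ℤ) : Function.Surjective (socMap (cycleProj I n)) :=
    socMap_surjective (cycleIncl_injective I n) (cycleProj_surjective hI.exact n) (cycle_exact I n)
      (hv n)
  have hstep (n : ℤ) : InjectiveStep (soc (cycleModule I n)) (soc (cycleModule I (n + 1))) :=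
    ⟨soc (I.X n), socMap (cycleIncl I n), socMap (cycleProj I n), injective_soc _ (hI.injective n),
      socMap_injective (cycleIncl_injective I n), hsurj n,
      socMap_exact (cycleIncl_injective I n) (cycle_exact I n)⟩
  refine gorensteinInjective_of_class (fun X => ∃ n, X = soc (cycleModule I n)) ?_ ?_ ?_ _ ⟨n, rfl⟩
  · rintro _ ⟨n, rfl⟩
    exact ⟨_, ⟨n + 1, rfl⟩, hstep n⟩
  · rintro _ ⟨n, rfl⟩
    refine ⟨_, ⟨n - 1, rfl⟩, ?_⟩
    have := hstep (n - 1)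
    rwa [sub_add_cancel] at this
  · rintro _ E ⟨n, rfl⟩ hE
    obtain ⟨w, hS⟩ := shortExact_mk _ _ (socMap_injective (cycleIncl_injective I n)) (hsurj n)
      (socMap_exact (cycleIncl_injective I n) (cycle_exact I n))
    refine ext_subsingleton_of_lift hS (injective_soc _ (hI.injective n)) fun f => ?_
    obtain ⟨g, hg⟩ := IsCompleteInjectiveResolution.exists_lift
      (homExact_triv hI E hE (hcomp.exact_hom_coind I hI E hE)) n (trivLift f)
    refine ⟨trivDesc g, ?_⟩
    refine soc_hom_ext fun x => ?_
    exact DFunLike.congr_fun (ModuleCat.hom_ext_iff.1 hg) (toTriv R M E x)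

theorem Psi_of_gorensteinInjective (hcomp : IsCoCompatible R M M)
    (hY : gorensteinInjective (TensorRing R M)ᵐᵒᵖ Y) :
    Psi R M (gorensteinInjective Rᵐᵒᵖ) Y := by
  obtain ⟨I, hI, ⟨e⟩⟩ := hY
  exact Psi_of_iso (fun _ _ e h => gorensteinInjective_of_iso e h) (cycleIso I ≪≫ e.symm)
    ⟨structureMap_cycleModule_surjective hI (hcomp.exact_hom I hI) 0,
      gorensteinInjective_soc_cycleModule hI hcomp 0⟩

end CoCompatible

end

section

variable {R : Type u} [Ring R]
variable {M : Type u} [AddCommGroup M] [Module R M] [Module Rᵐᵒᵖ M] [SMulCommClass R Rᵐᵒᵖ M]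

/-! ### Surjectivity of induced maps on `Hom_{R^op}(M^{⊗ i}, -)` -/

section Surjectivity

variable {A B C : Type u} [AddCommGroup A] [Module Rᵐᵒᵖ A] [AddCommGroup B] [Module Rᵐᵒᵖ B]
  [AddCommGroup C] [Module Rᵐᵒᵖ C]

theorem RHom.map_surjective_of_ext {f : A →ₗ[Rᵐᵒᵖ] B} {g : B →ₗ[Rᵐᵒᵖ] C}
    (hf : Function.Injective f) (hg : Function.Surjective g) (hfg : Function.Exact f g)
    (h : Subsingleton (Abelian.Ext.{u} (ModuleCat.of Rᵐᵒᵖ M) (ModuleCat.of Rᵐᵒᵖ A) 1)) :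
    Function.Surjective (RHom.map R M g) := by
  intro φ
  obtain ⟨w, hS⟩ := shortExact_mk (ModuleCat.ofHom f) (ModuleCat.ofHom g) hf hg hfg
  obtain ⟨ψ, hψ⟩ := exists_lift_of_ext hS h (ModuleCat.ofHom (RHom.equiv R M C φ))
  exact ⟨(RHom.equiv R M B).symm ψ.hom,
    RHom.ext fun m => DFunLike.congr_fun (ModuleCat.hom_ext_iff.1 hψ) m⟩

/-- By currying, `Hom(M^{⊗ (i+1)}, -)` is `Hom(M, Hom(M^{⊗ i}, -))`, so the induction only needs
`Ext¹` from `M` itself, the form in which co-admissibility supplies it. -/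
theorem RHom.map_tpow_surjective_of_ext {f : A →ₗ[Rᵐᵒᵖ] B} {g : B →ₗ[Rᵐᵒᵖ] C}
    (hf : Function.Injective f) (hg : Function.Surjective g) (hfg : Function.Exact f g)
    (h : ∀ i, Subsingleton (Abelian.Ext.{u} (ModuleCat.of Rᵐᵒᵖ M)
      (ModuleCat.of Rᵐᵒᵖ (RHom R (TPow R M i) A)) 1)) (i : ℕ) :
    Function.Surjective (RHom.map R (TPow R M i) g) := by
  induction i with
  | zero =>
    intro φ
    obtain ⟨c, rfl⟩ := (RHom.scalarEquiv R M C).surjective φ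
    obtain ⟨b, rfl⟩ := hg c
    exact ⟨RHom.scalarEquiv R M B b, RHom.ext fun x => g.map_smul _ b⟩
  | succ i ih =>
    intro φ
    obtain ⟨ψ, hψ⟩ := RHom.map_surjective_of_ext (RHom.map_injective R (TPow R M i) hf) ih
      (RHom.map_exact R (TPow R M i) hf hfg) (h i) (RHom.curry R M C i φ)
    refine ⟨(RHom.curry R M B i).symm ψ, RHom.succ_ext fun m x => ?_⟩
    rw [RHom.map_apply, RHom.curry_symm_cons, ← RHom.curry_apply, ← hψ]
    rfl

/-- Two surjective maps with the same kernel have isomorphic targets. -/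
def equivOfKerEq {S : Type u} [Ring S] {A B C : Type u} [AddCommGroup A] [Module S A]
    [AddCommGroup B] [Module S B] [AddCommGroup C] [Module S C] (f : A →ₗ[S] B) (g : A →ₗ[S] C)
    (hf : Function.Surjective f) (hg : Function.Surjective g)
    (h : LinearMap.ker f = LinearMap.ker g) : B ≃ₗ[S] C :=
  (f.quotKerEquivOfSurjective hf).symm.trans
    ((Submodule.quotEquivOfEq _ _ h).trans (g.quotKerEquivOfSurjective hg))

/-- The middle kernel in `0 → ker f → ker (g f) → ker g → 0` inherits the vanishing of `Ext¹`. -/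
theorem ext_subsingleton_ker_comp {S : Type u} [Ring S] {A B C : Type u} [AddCommGroup A]
    [Module S A] [AddCommGroup B] [Module S B] [AddCommGroup C] [Module S C] (f : A →ₗ[S] B)
    (g : B →ₗ[S] C) (hf : Function.Surjective f) {X : ModuleCat.{u} S}
    (h : Subsingleton (Abelian.Ext.{u} X (ModuleCat.of S (LinearMap.ker f)) 1))
    (h' : Subsingleton (Abelian.Ext.{u} X (ModuleCat.of S (LinearMap.ker g)) 1)) :
    Subsingleton (Abelian.Ext.{u} X (ModuleCat.of S (LinearMap.ker (g ∘ₗ f))) 1) := by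
  let i : LinearMap.ker f →ₗ[S] LinearMap.ker (g ∘ₗ f) :=
    Submodule.inclusion (LinearMap.ker_le_ker_comp f g)
  let p : LinearMap.ker (g ∘ₗ f) →ₗ[S] LinearMap.ker g :=
    (f.comp (Submodule.subtype _)).codRestrict _ fun x => x.2
  obtain ⟨w, hS⟩ := shortExact_mk (ModuleCat.ofHom i) (ModuleCat.ofHom p)
    (Submodule.inclusion_injective (LinearMap.ker_le_ker_comp f g)) (by
      rintro ⟨b, hb⟩
      obtain ⟨a, rfl⟩ := hf b
      exact ⟨⟨a, hb⟩, rfl⟩) (by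
      intro x
      constructor
      · intro hx
        exact ⟨⟨x.1, congrArg Subtype.val hx⟩, rfl⟩
      · rintro ⟨y, rfl⟩
        exact Subtype.ext y.2)
  exact ext_subsingleton_middle_right hS h h'

end Surjectivity

/-! ### The filtration of a right module over the tensor ring -/

variable {Y Z : ModuleCat.{u} (TensorRing R M)ᵐᵒᵖ}

theorem TensorRing.exists_of_mul_gen (i : ℕ) (x : TPow R M i) (m : M) :
    ∃ z : TPow R M (i + 1), of R M i x * gen R M m = of R M (i + 1) z := by
  -- Only the multiplicative half is wanted; the target module `M` and the zero map are
  -- placeholders.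
  obtain ⟨z, hz, -⟩ := RHom.snocLift_of_mul_gen R M M i 0 x m
  exact ⟨z, hz⟩

/-- The map `Y → Hom_{R^op}(M^{⊗ k}, Y)`, `y ↦ x ↦ y x`. -/
def actionMap (Y : ModuleCat.{u} (TensorRing R M)ᵐᵒᵖ) (k : ℕ) :
    (forgetful R M).obj Y →ₗ[Rᵐᵒᵖ] RHom R (TPow R M k) ((forgetful R M).obj Y) where
  toFun y := (RHom.equiv R (TPow R M k) _).symm
    { toFun := fun x => res R M Y (op (TensorRing.of R M k x) • (res R M Y).symm y)
      map_add' := fun x x' => by rw [map_add, MulOpposite.op_add, add_smul, map_add]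
      map_smul' := fun r x => by
        obtain ⟨r, rfl⟩ := op_surjective r
        rw [← TensorRing.of_mul_incl, op_mul, mul_smul, RingHom.id_apply, op_smul_res] }
  map_add' y z := RHom.ext fun x => by
    refine (congrArg (res R M Y) (smul_add (op (TensorRing.of R M k x)) ((res R M Y).symm y)
      ((res R M Y).symm z))).trans (map_add _ _ _)
  map_smul' r y := RHom.ext fun x => by
    obtain ⟨r, rfl⟩ := op_surjective r
    obtain ⟨y, rfl⟩ := (res R M Y).surjective y
    change res R M Y (op (TensorRing.of R M k x) • op (TensorRing.incl R M r) • y) =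
      res R M Y (op (TensorRing.of R M k (r • x)) • y)
    rw [← mul_smul, ← op_mul, TensorRing.incl_mul_of]

theorem actionMap_res (k : ℕ) (y : Y) (x : TPow R M k) :
    RHom.equiv R (TPow R M k) _ (actionMap Y k (res R M Y y)) x =
      res R M Y (op (TensorRing.of R M k x) • y) := rfl

theorem actionMap_eq_zero_iff (k : ℕ) (y : Y) : actionMap Y k (res R M Y y) = 0 ↔
    ∀ x : TPow R M k, op (TensorRing.of R M k x) • y = 0 := by
  constructor
  · intro h x
    apply (res R M Y).injective
    rw [← actionMap_res, h, map_zero, map_zero, LinearMap.zero_apply]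
  · intro h
    refine RHom.ext fun x => ?_
    rw [actionMap_res, h, map_zero, map_zero, LinearMap.zero_apply]

/-- Degree `k + 1` is generated by the products `x m`, so it kills `y` exactly when degree `k`
carries `y` into `soc Y`. Every induction along the filtration rests on this. -/
theorem smul_of_succ_eq_zero_iff (k : ℕ) (y : Y) :
    (∀ x : TPow R M (k + 1), op (TensorRing.of R M (k + 1) x) • y = 0) ↔
      ∀ (x : TPow R M k) (m : M),
        op (TensorRing.gen R M m) • op (TensorRing.of R M k x) • y = 0 := by
  constructor
  · intro h x m
    obtain ⟨z, hz⟩ := TensorRing.exists_of_mul_gen k x m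
    rw [← mul_smul, ← op_mul, hz, h]
  · intro h x
    refine TensorRing.of_succ_induction (p := fun t => op t • y = 0) x ?_ (fun x m => ?_)
      (fun s t hs ht => ?_)
    · rw [MulOpposite.op_zero, zero_smul]
    · rw [op_mul, mul_smul, h]
    · rw [MulOpposite.op_add, add_smul, hs, ht, add_zero]

theorem eq_zero_of_smul_of_zero (y : Y) (h : ∀ x : TPow R M 0, op (TensorRing.of R M 0 x) • y = 0) :
    y = 0 := by
  have := h (TPow.scalar R M 1)
  rwa [← TensorRing.incl_apply, map_one, op_one, one_smul] at this

theorem smul_of_eq_zero_of_nilpotent {N : ℕ} (hN : IsNilpotentBimodule R M N) (y : Y)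
    (x : TPow R M (N + 1)) : op (TensorRing.of R M (N + 1) x) • y = 0 := by
  have : Subsingleton (TPow R M (N + 1)) := hN
  rw [Subsingleton.elim x 0, map_zero, MulOpposite.op_zero, zero_smul]

theorem ker_actionMap_succ (k : ℕ) : LinearMap.ker (actionMap Y (k + 1)) =
    LinearMap.ker (RHom.map R (TPow R M k) (structureMap Y) ∘ₗ actionMap Y k) := by
  ext y
  obtain ⟨y, rfl⟩ := (res R M Y).surjective y
  rw [LinearMap.mem_ker, LinearMap.mem_ker, actionMap_eq_zero_iff, smul_of_succ_eq_zero_iff,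
    LinearMap.comp_apply]
  constructor
  · intro h
    exact RHom.ext fun x => (soc.structureMap_eq_zero_iff _).2 (h x)
  · intro h x
    exact (soc.structureMap_eq_zero_iff _).1 (congrArg (fun φ => RHom.equiv R (TPow R M k) _ φ x) h)

/-- The kernel of `Hom_{R^op}(M^{⊗ k}, v)`, where `v` is the structure map of `Y`, is
`Hom_{R^op}(M^{⊗ k}, ker v)`. -/
def kerMapStructureMap (Y : ModuleCat.{u} (TensorRing R M)ᵐᵒᵖ) (k : ℕ) :
    RHom R (TPow R M k) (soc Y) ≃ₗ[Rᵐᵒᵖ] LinearMap.ker (RHom.map R (TPow R M k) (structureMap Y)) :=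
  (LinearEquiv.ofInjective _ (RHom.map_injective R (TPow R M k)
    (f := Submodule.subtype (LinearMap.ker (structureMap Y))) Subtype.val_injective)).trans
    (LinearEquiv.ofEq _ _ ((LinearMap.exact_iff.1 (RHom.map_exact R (TPow R M k)
      Subtype.val_injective (LinearMap.exact_subtype_ker_map (structureMap Y)))).symm))

/-- The two claims feed each other. Up to currying, `actionMap Y (k + 1)` is the structure map
followed by `Hom(M, actionMap Y k)`, which is surjective when `Ext¹` from `M` to the kernel
vanishes. Surjectivity in turn gives the exact sequence `0 → ker (actionMap Y k) → ker (actionMap Y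
(k + 1)) → Hom(M^{⊗ k}, soc Y) → 0`, which carries the vanishing on. -/
theorem actionMap_surjective_and_ext (hv : Function.Surjective (structureMap Y))
    (hext : ∀ i, Subsingleton (Abelian.Ext.{u} (ModuleCat.of Rᵐᵒᵖ M)
      (ModuleCat.of Rᵐᵒᵖ (RHom R (TPow R M i) (soc Y))) 1)) (k : ℕ) :
    Function.Surjective (actionMap Y k) ∧
    Subsingleton (Abelian.Ext.{u} (ModuleCat.of Rᵐᵒᵖ M)
      (ModuleCat.of Rᵐᵒᵖ (LinearMap.ker (actionMap Y k))) 1) := by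
  induction k with
  | zero =>
    constructor
    · intro φ
      obtain ⟨y, rfl⟩ := (RHom.scalarEquiv R M _).surjective φ
      refine ⟨y, RHom.ext fun x => ?_⟩
      obtain ⟨r, rfl⟩ := (TPow.scalar R M).surjective x
      rfl
    · have h0 : Subsingleton (LinearMap.ker (actionMap Y 0)) := by
        refine subsingleton_of_forall_eq 0 ?_
        rintro ⟨y, hy⟩
        obtain ⟨y, rfl⟩ := (res R M Y).surjective y
        apply Subtype.ext
        change res R M Y y = 0
        rw [eq_zero_of_smul_of_zero y ((actionMap_eq_zero_iff 0 y).1 hy), map_zero]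
      have := (ModuleCat.isZero_of_subsingleton
        (ModuleCat.of Rᵐᵒᵖ (LinearMap.ker (actionMap Y 0)))).injective
      exact subsingleton_of_forall_eq 0 Abelian.Ext.eq_zero_of_injective
  | succ k ih =>
    obtain ⟨hs, he⟩ := ih
    constructor
    · intro φ
      obtain ⟨ψ, hψ⟩ := RHom.map_surjective_of_ext
        (f := Submodule.subtype (LinearMap.ker (actionMap Y k))) Subtype.val_injective hs
        (LinearMap.exact_subtype_ker_map _) he (RHom.curry R M _ k φ)
      obtain ⟨y, rfl⟩ := exists_structureMap_eq hv ψ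
      refine ⟨res R M Y y, RHom.succ_ext fun m x => ?_⟩
      rw [actionMap_res, ← TensorRing.gen_mul_of, op_mul, mul_smul, ← actionMap_res,
        ← structureMap_res, ← RHom.map_apply, hψ, RHom.curry_apply]
    · rw [ker_actionMap_succ]
      exact ext_subsingleton_ker_comp _ _ hs he
        (ext_subsingleton_of_iso_right (kerMapStructureMap Y k).toModuleIso (hext k))

/-- By nilpotency the kernels of the action maps exhaust `Y` at step `N + 1`. -/
theorem ext_forgetful_subsingleton (hv : Function.Surjective (structureMap Y))
    (hext : ∀ i, Subsingleton (Abelian.Ext.{u} (ModuleCat.of Rᵐᵒᵖ M)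
      (ModuleCat.of Rᵐᵒᵖ (RHom R (TPow R M i) (soc Y))) 1)) {N : ℕ}
    (hN : IsNilpotentBimodule R M N) :
    Subsingleton (Abelian.Ext.{u} (ModuleCat.of Rᵐᵒᵖ M) ((forgetful R M).obj Y) 1) := by
  have h := (actionMap_surjective_and_ext hv hext (N + 1)).2
  have htop : LinearMap.ker (actionMap Y (N + 1)) = ⊤ := by
    refine eq_top_iff.2 fun y _ => ?_
    obtain ⟨y, rfl⟩ := (res R M Y).surjective y
    exact LinearMap.mem_ker.2 ((actionMap_eq_zero_iff (N + 1) y).2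
      (smul_of_eq_zero_of_nilpotent hN y))
  rw [htop] at h
  exact ext_subsingleton_of_iso_right
    (Submodule.topEquiv (R := Rᵐᵒᵖ) (M := (forgetful R M).obj Y)).toModuleIso h

/-- Over a nilpotent bimodule, a map which is injective on the kernels of the structure maps is
injective. -/
theorem injective_of_socMap_injective {N : ℕ} (hN : IsNilpotentBimodule R M N) {f : Y ⟶ Z}
    (hf : Function.Injective (socMap f)) : Function.Injective f := by
  rw [injective_iff_map_eq_zero]
  intro y hy
  -- If degree `k + 1` kills `y`, the elements `y x` with `x` of degree `k` lie in `soc Y` and in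
  -- the kernel of `f`, so they vanish.
  have key : ∀ k, (∀ x : TPow R M k, op (TensorRing.of R M k x) • y = 0) → y = 0 := by
    intro k
    induction k with
    | zero => exact eq_zero_of_smul_of_zero y
    | succ k ih =>
      intro h
      refine ih fun x => ?_
      have hs := (smul_of_succ_eq_zero_iff k y).1 h x
      rw [← soc.incl_mk _ hs, ← map_zero (soc.incl Y)]
      congr 1
      apply hf
      apply soc.incl_injective
      rw [incl_socMap, soc.incl_mk, map_smul, hy, smul_zero, map_zero, map_zero]
  exact key (N + 1) (smul_of_eq_zero_of_nilpotent hN y)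

end

section

variable {R : Type u} [Ring R]
variable {M : Type u} [AddCommGroup M] [Module R M] [Module Rᵐᵒᵖ M] [SMulCommClass R Rᵐᵒᵖ M]
variable {Y : ModuleCat.{u} (TensorRing R M)ᵐᵒᵖ} {N : ℕ}

/-! ### Modules in `Ψ` are Gorenstein injective -/

/-- The new term is the cokernel of the map `Y → Coind E` adjoint to an extension of `soc Y → E`. On
socles this gives back `0 → soc Y → E → D → 0`, so the cokernel has socle `D`. -/
theorem Psi_succ (hN : IsNilpotentBimodule R M N) (hadm : IsCoAdmissible R M)
    (hY : Psi R M (gorensteinInjective Rᵐᵒᵖ) Y) :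
    ∃ C, Psi R M (gorensteinInjective Rᵐᵒᵖ) C ∧ InjectiveStep Y C := by
  obtain ⟨hv, hH⟩ := hY
  obtain ⟨D, hD, E, f, g, hE, hf, hg, hfg⟩ := gorensteinInjective_succ hH
  let ι : soc Y ⟶ (forgetful R M).obj Y := ModuleCat.ofHom (Y := (forgetful R M).obj Y)
    (Submodule.subtype (LinearMap.ker (structureMap Y)))
  have hι : Mono ι := (ModuleCat.mono_iff_injective ι).2 Subtype.val_injective
  let F : (forgetful R M).obj Y ⟶ E := Injective.factorThru f ι
  have hF (y : soc Y) : F (res R M Y (soc.incl Y y)) = f y :=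
    DFunLike.congr_fun (ModuleCat.hom_ext_iff.1 (Injective.comp_factorThru f ι)) y
  let φ : Y ⟶ (coind R M).obj E := Coind.lift F
  have hφsoc (y : soc Y) : Coind.socEquiv E (socMap φ y) = f y := by
    rw [Coind.socEquiv_apply, incl_socMap, Coind.eval_lift, op_one, one_smul, hF]
  have hφ : Function.Injective φ := injective_of_socMap_injective hN fun x y h => hf (by
    rw [← hφsoc, ← hφsoc, h])
  let π : (coind R M).obj E ⟶
      ModuleCat.of (TensorRing R M)ᵐᵒᵖ ((coind R M).obj E ⧸ LinearMap.range φ.hom) :=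
    ModuleCat.ofHom (Submodule.mkQ _)
  have hπ : Function.Surjective π := Submodule.mkQ_surjective _
  have hφπ : Function.Exact φ π := LinearMap.exact_map_mkQ_range φ.hom
  -- This makes `Hom(M, Coind E) → Hom(M, C)` surjective for the cokernel `C`, so that the structure
  -- map of `C` is surjective.
  have hext := ext_forgetful_subsingleton hv (hadm.ext_hom_gorenstein _ hH) hN
  have hsocπ := socMap_surjective hφ hπ hφπ hv
  refine ⟨_, ⟨structureMap_surjective_of_lift (g := π) Coind.structureMap_surjective
    (RHom.map_surjective_of_ext (forgetful_injective hφ) (forgetful_surjective hπ)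
      (forgetful_exact hφπ) hext), ?_⟩, _, φ, π, inferInstance, hφ, hπ, hφπ⟩
  let q : soc ((coind R M).obj E) →ₗ[Rᵐᵒᵖ] D := g.hom ∘ₗ (Coind.socEquiv E).toLinearMap
  have hq : Function.Surjective q := hg.comp (Coind.socEquiv E).surjective
  refine gorensteinInjective_of_iso (equivOfKerEq q (socMap π).hom hq hsocπ ?_).toModuleIso hD
  ext j
  rw [LinearMap.mem_ker, LinearMap.mem_ker]
  refine (hfg (Coind.socEquiv E j)).trans (Iff.trans ?_ (socMap_exact hφ hφπ j).symm)
  constructor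
  · rintro ⟨y, hy⟩
    exact ⟨y, (Coind.socEquiv E).injective (by rw [hφsoc, hy])⟩
  · rintro ⟨y, rfl⟩
    exact ⟨y, (hφsoc y).symm⟩

/-- In a step `0 → Y → J → C → 0`, maps `[W, 0] → C` are maps `W → soc C`, and these lift to `soc J`
because the kernel of `soc J → soc C` is `soc Y`. -/
theorem ext_triv_subsingleton (hN : IsNilpotentBimodule R M N) (hadm : IsCoAdmissible R M)
    (hY : Psi R M (gorensteinInjective Rᵐᵒᵖ) Y) (W : ModuleCat.{u} Rᵐᵒᵖ)
    (hW : Subsingleton (Abelian.Ext.{u} W (soc Y) 1)) :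
    Subsingleton (Abelian.Ext.{u} ((triv R M).obj W) Y 1) := by
  obtain ⟨C, -, J, f, g, hJ, hf, hg, hfg⟩ := Psi_succ hN hadm hY
  obtain ⟨w, hS⟩ := shortExact_mk f g hf hg hfg
  obtain ⟨w', hS'⟩ := shortExact_mk (socMap f) (socMap g) (socMap_injective hf)
    (socMap_surjective hf hg hfg hY.1) (socMap_exact hf hfg)
  refine ext_subsingleton_of_lift hS hJ fun h => ?_
  obtain ⟨k, hk⟩ := exists_lift_of_ext hS' hW (trivDesc h)
  refine ⟨trivLift k, ModuleCat.hom_ext (LinearMap.ext fun x => ?_)⟩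
  obtain ⟨x, rfl⟩ := (toTriv R M W).surjective x
  exact congrArg (soc.incl C) (DFunLike.congr_fun (ModuleCat.hom_ext_iff.1 hk) x)

/-- For `X = Hom(M^{⊗ i}, E)` the sequence `0 → [X, 0] → Coind X → Coind Hom(M, X) → 0` ends in the
case `i + 1`, by currying. Descending induction starts at `i = N + 1`, where `X = 0`. -/
theorem ext_coind_subsingleton (hN : IsNilpotentBimodule R M N) (hadm : IsCoAdmissible R M)
    (hY : Psi R M (gorensteinInjective Rᵐᵒᵖ) Y) (E : ModuleCat.{u} Rᵐᵒᵖ) (hE : Injective E)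
    (i : ℕ) (hi : i ≤ N + 1) :
    Subsingleton (Abelian.Ext.{u}
      ((coind R M).obj (ModuleCat.of Rᵐᵒᵖ (RHom R (TPow R M i) E))) Y 1) := by
  induction hi using Nat.decreasingInduction with
  | self =>
    have : Subsingleton (TPow R M (N + 1)) := hN
    have h0 : Subsingleton ((coind R M).obj (ModuleCat.of Rᵐᵒᵖ (RHom R (TPow R M (N + 1)) E))) :=
      ⟨fun j k => Coind.ext fun t => RHom.ext fun x => by
        rw [Subsingleton.elim x 0, map_zero, map_zero]⟩
    refine subsingleton_of_forall_eq 0 fun x => ?_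
    rw [← Abelian.Ext.mk₀_id_comp x,
      (ModuleCat.isZero_of_subsingleton _).eq_of_src (𝟙 _) 0, Abelian.Ext.mk₀_zero,
      Abelian.Ext.zero_comp]
  | of_succ i hi ih =>
    obtain ⟨w, hS⟩ := shortExact_mk _ _ (Coind.fromTriv_injective (R := R) (M := M)
        (E := ModuleCat.of Rᵐᵒᵖ (RHom R (TPow R M i) E)))
      Coind.toCoindRHom_surjective Coind.fromTriv_exact
    refine ext_subsingleton_middle_left hS
      (ext_triv_subsingleton hN hadm hY _ (hadm.ext_hom_injective _ _ hY.2 hE i)) ?_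
    let e := (coind R M).mapIso (RHom.curry R M E i).toModuleIso
    exact ext_subsingleton_of_retract e.inv e.hom e.inv_hom_id ih

theorem ext_coind_RHom_subsingleton (hN : IsNilpotentBimodule R M N) (hadm : IsCoAdmissible R M)
    (hY : Psi R M (gorensteinInjective Rᵐᵒᵖ) Y) (E : ModuleCat.{u} Rᵐᵒᵖ) (hE : Injective E) :
    Subsingleton (Abelian.Ext.{u} ((coind R M).obj (ModuleCat.of Rᵐᵒᵖ (RHom R M E))) Y 1) := by
  let e := (coind R M).mapIso ((RHom.mapEquiv R M (RHom.scalarEquiv R M E)).trans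
    (RHom.curry R M E 0).symm).toModuleIso
  exact ext_subsingleton_of_retract e.hom e.inv e.hom_inv_id
    (ext_coind_subsingleton hN hadm hY E hE 1 (by omega))

theorem ext_injective_subsingleton (hN : IsNilpotentBimodule R M N) (hadm : IsCoAdmissible R M)
    (hY : Psi R M (gorensteinInjective Rᵐᵒᵖ) Y) (I : ModuleCat.{u} (TensorRing R M)ᵐᵒᵖ)
    (hI : Injective I) : Subsingleton (Abelian.Ext.{u} I Y 1) := by
  obtain ⟨E, s, r, hE, hsr⟩ := exists_retract_coind I hI
  let e := (coind R M).mapIso (RHom.scalarEquiv R M E).toModuleIso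
  refine ext_subsingleton_of_retract s r hsr (ext_subsingleton_of_retract e.hom e.inv e.hom_inv_id
    (ext_coind_subsingleton hN hadm hY E hE 0 (by omega)))

/-- A map from a coinduced module is surjective if it lifts, in every degree, the maps to the
kernel of the structure map. -/
theorem surjective_of_coind (hN : IsNilpotentBimodule R M N) {E : ModuleCat.{u} Rᵐᵒᵖ}
    (φ : (coind R M).obj E ⟶ Y) (g : E ⟶ soc Y)
    (hφ : ∀ e, φ (soc.incl _ ((Coind.socEquiv E).symm e)) = soc.incl Y (g e))
    (hg : ∀ i, Function.Surjective (RHom.map R (TPow R M i) g.hom)) : Function.Surjective φ := by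
  -- Elements killed by degree `k` are hit: modulo the image, an element killed by degree `k + 1` is
  -- replaced by one killed by degree `k`.
  have key (k : ℕ) : ∀ y : Y, (∀ x : TPow R M k, op (TensorRing.of R M k x) • y = 0) →
      ∃ j, φ j = y := by
    induction k with
    | zero => exact fun y h => ⟨0, by rw [map_zero, eq_zero_of_smul_of_zero y h]⟩
    | succ k ih =>
      intro y h
      have hs := (smul_of_succ_eq_zero_iff k y).1 h
      let θ₀ : RHom R (TPow R M k) (soc Y) := (RHom.equiv R (TPow R M k) _).symm
        { toFun := fun x => soc.mk (op (TensorRing.of R M k x) • y) (hs x)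
          map_add' := fun x x' => soc.incl_injective (by
            rw [(soc.incl Y).map_add, soc.incl_mk, soc.incl_mk, soc.incl_mk, map_add,
              MulOpposite.op_add, add_smul])
          map_smul' := fun r x => soc.incl_injective (by
            obtain ⟨r, rfl⟩ := op_surjective r
            rw [RingHom.id_apply, soc.incl_op_smul, soc.incl_mk, soc.incl_mk,
              ← TensorRing.of_mul_incl, op_mul, mul_smul]) }
      obtain ⟨θ, hθ⟩ := hg k θ₀
      -- `j` is concentrated in degree `k`, where it is a lift `θ` of `x ↦ y x` to `E`. Then `j x`
      -- vanishes in positive degrees, so it is the socle element given by `θ x`, and `y - φ j` is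
      -- killed by degree `k`.
      let j : (coind R M).obj E := Coind.ofComponents fun i =>
        if h : i = k then h ▸ RHom.equiv R (TPow R M k) E θ else 0
      have hj (x : TPow R M k) :
          Coind.eval j (TensorRing.of R M k x) = RHom.equiv R (TPow R M k) E θ x := by
        rw [Coind.eval_ofComponents, dif_pos rfl]
      have hj' (i : ℕ) (hi : i ≠ k) (x : TPow R M i) :
          Coind.eval j (TensorRing.of R M i x) = 0 := by
        rw [Coind.eval_ofComponents, dif_neg hi, LinearMap.zero_apply]
      have hjx (x : TPow R M k) : op (TensorRing.of R M k x) • j =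
          soc.incl _ ((Coind.socEquiv E).symm (RHom.equiv R (TPow R M k) E θ x)) := by
        refine Coind.ext fun t => ?_
        rw [Coind.eval_smul, Coind.eval_socEquiv_symm]
        refine TensorRing.induction_on t ?_ (fun i z => ?_) (fun s t hs ht => ?_)
        · rw [mul_zero, map_zero, map_zero, MulOpposite.op_zero, zero_smul]
        · cases i with
          | zero =>
            obtain ⟨r, rfl⟩ := (TPow.scalar R M).surjective z
            rw [← TensorRing.incl_apply, TensorRing.augmentation_incl, Coind.eval_mul_incl, hj]
          | succ i =>
            obtain ⟨w, hw⟩ := TensorRing.exists_of_mul_of R M k (i + 1) x z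
            rw [hw, hj' _ (by omega), TensorRing.augmentation_of_succ, MulOpposite.op_zero,
              zero_smul]
        · rw [mul_add, map_add, map_add, MulOpposite.op_add, add_smul, hs, ht]
      obtain ⟨j', hj'⟩ := ih (y - φ j) fun x => by
        rw [smul_sub, ← map_smul, hjx, hφ, sub_eq_zero]
        exact (congrArg (fun θ => soc.incl Y (RHom.equiv R (TPow R M k) _ θ x)) hθ).symm
      exact ⟨j' + j, by rw [map_add, hj', sub_add_cancel]⟩
  exact fun y => key (N + 1) y (smul_of_eq_zero_of_nilpotent hN y)

/-- The new term is the kernel of an extension `Coind E → Y` of `[E, 0] → [soc Y, 0] → Y`; the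
obstruction lies in `Ext¹(Coind Hom(M, E), Y) = 0`. On socles this extension is `E → soc Y`, so the
kernel has socle `D`. -/
theorem Psi_pred (hN : IsNilpotentBimodule R M N) (hadm : IsCoAdmissible R M)
    (hY : Psi R M (gorensteinInjective Rᵐᵒᵖ) Y) :
    ∃ K, Psi R M (gorensteinInjective Rᵐᵒᵖ) K ∧ InjectiveStep K Y := by
  obtain ⟨D, hD, E, f, g, hE, hf, hg, hfg⟩ := gorensteinInjective_pred hY.2
  obtain ⟨w, hS⟩ := shortExact_mk (Coind.fromTriv R M E) (Coind.toCoindRHom R M E)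
    Coind.fromTriv_injective Coind.toCoindRHom_surjective Coind.fromTriv_exact
  obtain ⟨φ, hφ⟩ := exists_extension_of_ext hS (ext_coind_RHom_subsingleton hN hadm hY E hE)
    (trivLift g)
  change (coind R M).obj E ⟶ Y at φ
  have hφe (e : E) : φ (soc.incl _ ((Coind.socEquiv E).symm e)) = soc.incl Y (g e) :=
    DFunLike.congr_fun (ModuleCat.hom_ext_iff.1 hφ) (toTriv R M E e)
  have hφsoc (j : soc ((coind R M).obj E)) : socMap φ j = g (Coind.socEquiv E j) := by
    apply soc.incl_injective
    rw [incl_socMap, ← hφe, LinearEquiv.symm_apply_apply]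
  have hφs : Function.Surjective φ := surjective_of_coind hN φ g hφe
    (RHom.map_tpow_surjective_of_ext hf hg hfg (hadm.ext_hom_gorenstein D hD))
  let ι : ModuleCat.of (TensorRing R M)ᵐᵒᵖ (LinearMap.ker φ.hom) ⟶ (coind R M).obj E :=
    ModuleCat.ofHom (Submodule.subtype _)
  have hι : Function.Injective ι := Subtype.val_injective
  have hιφ : Function.Exact ι φ := LinearMap.exact_subtype_ker_map φ.hom
  have hsoc : Function.Surjective (socMap φ) := fun y => by
    obtain ⟨e, rfl⟩ := hg y
    exact ⟨(Coind.socEquiv E).symm e, by rw [hφsoc, LinearEquiv.apply_symm_apply]⟩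
  refine ⟨_, ⟨structureMap_surjective_of_socMap hι hιφ Coind.structureMap_surjective hsoc, ?_⟩,
    _, ι, φ, inferInstance, hι, hφs, hιφ⟩
  have hex : Function.Exact (socMap ι) (socMap φ) := socMap_exact hι hιφ
  let p : soc (ModuleCat.of (TensorRing R M)ᵐᵒᵖ (LinearMap.ker φ.hom)) →ₗ[Rᵐᵒᵖ] E :=
    (Coind.socEquiv E).toLinearMap ∘ₗ (socMap ι).hom
  have hp : Function.Injective p := (Coind.socEquiv E).injective.comp (socMap_injective hι)
  -- Both images in `E` are the kernel of `g`, which identifies `D` with the socle of the kernel of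
  -- `φ`.
  have hrange : LinearMap.range f.hom = LinearMap.range p := by
    ext e
    refine (hfg e).symm.trans ?_
    obtain ⟨j, rfl⟩ := (Coind.socEquiv (M := M) E).surjective e
    refine (iff_of_eq (congrArg (· = 0) (hφsoc j).symm)).trans ?_
    refine (hex j).trans ?_
    constructor
    · rintro ⟨k, rfl⟩
      exact ⟨k, rfl⟩
    · rintro ⟨k, hk⟩
      exact ⟨k, (Coind.socEquiv E).injective hk⟩
  exact gorensteinInjective_of_iso (((LinearEquiv.ofInjective f.hom hf).trans
    (LinearEquiv.ofEq _ _ hrange)).trans (LinearEquiv.ofInjective p hp).symm).toModuleIso hD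

theorem gorensteinInjective_of_Psi (hN : IsNilpotentBimodule R M N) (hadm : IsCoAdmissible R M)
    (hY : Psi R M (gorensteinInjective Rᵐᵒᵖ) Y) :
    gorensteinInjective (TensorRing R M)ᵐᵒᵖ Y :=
  gorensteinInjective_of_class _ (fun _ h => Psi_succ hN hadm h) (fun _ h => Psi_pred hN hadm h)
    (fun _ I h hI => ext_injective_subsingleton hN hadm h I hI) Y hY

end

end TensorRings

end

theorem mainTheorem4 (R : Type u) [Ring R] (M : Type u) [AddCommGroup M] [Module R M]
    [Module Rᵐᵒᵖ M] [SMulCommClass R Rᵐᵒᵖ M] (N : ℕ)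
    (hN : TensorRings.IsNilpotentBimodule R M N)
    (hcomp : TensorRings.IsCoCompatible R M M) (hadm : TensorRings.IsCoAdmissible R M) :
    TensorRings.gorensteinInjective (TensorRings.TensorRing R M)ᵐᵒᵖ =
      TensorRings.Psi R M (TensorRings.gorensteinInjective Rᵐᵒᵖ) := by
  ext Y
  exact ⟨TensorRings.Psi_of_gorensteinInjective hcomp,
    TensorRings.gorensteinInjective_of_Psi hN hadm⟩
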